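/- Let $\mathscr{C}$ be a Krull--Schmidt extriangulated category (in the sense of Nakaoka and Palu) with bifunctor $\mathbb{E}$, having enough projectives and enough injectives and satisfying the condition (WIC): if $gf$ is an inflation then so is $f$, and if $gf$ is a deflation then so is $g$. For an object $X$ let $\Omega X$ be a syzygy of $X$ (there is an $\mathbb{E}$-triangle $\Omega X\to P\to X\dashrightarrow$ with $P$ projective), and put $\mathbb{E}^{i+1}(X,Y)=\mathbb{E}(\Omega^{i}X,Y)$ for $i\ge 0$. A subcategory of $\mathscr{C}$ means a full additive subcategory closed under isomorphisms and direct summands. An $\mathbb{E}$-triangle sequence is a sequence of morphisms obtained by splicing $\mathbb{E}$-triangles $K_{i+1}\to W_i\to K_i\dashrightarrow$. For a class $\omega$ of objects of $\mathscr{C}$ let $\omega^{\perp}$ be the class of all $Y$ with $\mathbb{E}^{i}(X,Y)=0$ for all $X\in\omega$ and all $i\ge 1$; $\omega$ is self-orthogonal if $\omega\subseteq\omega^{\perp}$. For $n\ge 0$ let $\hat\omega_n$ (respectively $\check\omega_n$) be the class of all objects $A$ having an $\mathbb{E}$-triangle sequence $W_n\to\cdots\to W_0\to A$ (respectively $A\to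 W^0\to\cdots\to W^n$) with all terms $W_i$ (respectively $W^i$) in $\omega$, so that $\hat\omega_0=\check\omega_0=\omega$; put $\hat\omega=\bigcup_n\hat\omega_n$ and $\check\omega=\bigcup_n\check\omega_n$. For $\omega$ self-orthogonal let ${}_{\omega}\mathcal{X}$ be the class of all $A$ having an $\mathbb{E}$-triangle sequence $\cdots\to W_1\to W_0\to A$, spliced from $\mathbb{E}$-triangles $K_{i+1}\to W_i\to K_i\dashrightarrow$ ($i\ge 0$, $K_0=A$) with all $W_i\in\omega$ and all $K_i\in\omega^{\perp}$. For classes $\mathcal{T}_1,\mathcal{T}_2$ of objects let $\mathrm{Pres}^{n}_{\mathcal{T}_2}(\mathcal{T}_1)$ (respectively $\mathrm{Copres}^{n}_{\mathcal{T}_2}(\mathcal{T}_1)$) be the class of all $X$ having an $\mathbb{E}$-triangle sequence $X'\to T_n\to\cdots\to T_1\to X$ (respectively $X\to T_1\to\cdots\to T_n\to X'$) with all $T_i\in\mathcal{T}_1$ and $X'\in\mathcal{T}_2$; write $\mathrm{Copres}^{n}(\mathcal{T}_1)=\mathrm{Copres}^{n}_{\mathscr{C}}(\mathcal{T}_1)$.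 A subcategory $\mathcal{T}$ is strongly contravariantly finite if every object $Z$ of $\mathscr{C}$ has an $\mathbb{E}$-triangle $K\to W\xrightarrow{g}Z\dashrightarrow$ where $W\in\mathcal{T}$ and every morphism from an object of $\mathcal{T}$ to $Z$ factors through $g$. A pair $(\mathcal{C},\mathcal{T})$ of subcategories is a tilting pair if $\mathcal{C}$ and $\mathcal{T}$ are self-orthogonal, $\mathcal{T}\subseteq\hat{\mathcal{C}}$ and $\mathcal{C}\subseteq\check{\mathcal{T}}$. It is an $n$-tilting pair if in addition $\mathcal{C}\text{-}\dim\mathcal{T}\le n$, where $\mathcal{C}\text{-}\dim M=\min\{m: M\in\hat{\mathcal{C}}_m\}$ and $\mathcal{C}\text{-}\dim\mathcal{T}$ is the least upper bound of $\mathcal{C}\text{-}\dim M$ over all $M\in\mathcal{T}$. Theorem. Let $n\ge 1$, and let $\mathcal{C}$ and $\mathcal{T}$ be subcategories of $\mathscr{C}$ such that $\mathcal{C}$ is self-orthogonal, $\mathcal{T}$ is strongly contravariantly finite, and $\mathcal{C}\subseteq\mathrm{Copres}^{n}(\mathrm{Pres}^{n}_{{}_{\mathcal{C}}\mathcal{X}}(\mathcal{T}))$.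 Then $(\mathcal{C},\mathcal{T})$ is an $n$-tilting pair if and only if $\mathrm{Pres}^{n}_{{}_{\mathcal{C}}\mathcal{X}}(\mathcal{T})=\mathcal{T}^{\perp}\cap{}_{\mathcal{C}}\mathcal{X}$. -/

import Mathlib

open CategoryTheory CategoryTheory.Limits Opposite

universe w v u

attribute [local instance] hasBinaryBiproducts_of_finite_biproducts

/-- An extriangulated structure (in the sense of Nakaoka and Palu) on an additive category `C`:
a biadditive functor `𝔼 : Cᵒᵖ × C → Ab` together with an additive realization `𝔰` satisfying
(ET3), (ET3)ᵒᵖ, (ET4) and (ET4)ᵒᵖ.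

The realization `𝔰`, which sends `δ ∈ 𝔼(Z, A)` to an equivalence class of sequences
`A ⟶ B ⟶ Z`, is encoded by the relation `Realizes x y δ`, meaning `𝔰(δ) = [A ⟶ B ⟶ Z]`. The
fields `exists_realizes`, `realizes_of_equiv` and `equiv_of_realizes` say that for each `δ` the
sequences realizing it form exactly one equivalence class. -/
structure ExtriangulatedStructure (C : Type u) [Category.{v} C] [Preadditive C]
    [HasFiniteBiproducts C] where
  /-- The functor `𝔼`; the group `𝔼(Z, A)` is `(E.obj (op Z)).obj A`. -/
  E : Cᵒᵖ ⥤ C ⥤ AddCommGrpCat.{w}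
  additive_left : E.Additive
  additive_right : ∀ Z : Cᵒᵖ, (E.obj Z).Additive
  /-- `Realizes x y δ` means `𝔰(δ) = [A ⟶ B ⟶ Z]` (with maps `x` and `y`). -/
  Realizes : ∀ {A B Z : C}, (A ⟶ B) → (B ⟶ Z) → ((E.obj (op Z)).obj A) → Prop
  exists_realizes : ∀ {A Z : C} (δ : (E.obj (op Z)).obj A),
    ∃ (B : C) (x : A ⟶ B) (y : B ⟶ Z), Realizes x y δ
  realizes_of_equiv : ∀ {A B B' Z : C} {δ : (E.obj (op Z)).obj A}
    {x : A ⟶ B} {y : B ⟶ Z} {x' : A ⟶ B'} {y' : B' ⟶ Z} (b : B ≅ B'),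
    x ≫ b.hom = x' → b.hom ≫ y' = y → Realizes x y δ → Realizes x' y' δ
  equiv_of_realizes : ∀ {A B B' Z : C} {δ : (E.obj (op Z)).obj A}
    {x : A ⟶ B} {y : B ⟶ Z} {x' : A ⟶ B'} {y' : B' ⟶ Z},
    Realizes x y δ → Realizes x' y' δ →
      ∃ b : B ≅ B', x ≫ b.hom = x' ∧ b.hom ≫ y' = y
  /-- Every morphism `(a, c) : δ ⟶ δ'` of extensions (`a_* δ = c^* δ'`) can be realized. -/
  realizes_hom : ∀ {A B Z A' B' Z' : C} {δ : (E.obj (op Z)).obj A}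
    {δ' : (E.obj (op Z')).obj A'} {x : A ⟶ B} {y : B ⟶ Z} {x' : A' ⟶ B'} {y' : B' ⟶ Z'},
    Realizes x y δ → Realizes x' y' δ' →
    ∀ (a : A ⟶ A') (c : Z ⟶ Z'),
      (E.obj (op Z)).map a δ = (E.map c.op).app A' δ' →
      ∃ b : B ⟶ B', x ≫ b = a ≫ x' ∧ y ≫ c = b ≫ y'
  /-- The split extension `0` is realized by `A ⟶ A ⊞ Z ⟶ Z`. -/
  realizes_zero : ∀ A Z : C,
    Realizes (biprod.inl : A ⟶ A ⊞ Z) (biprod.snd : A ⊞ Z ⟶ Z) (0 : (E.obj (op Z)).obj A)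
  /-- `𝔰(δ ⊕ δ') = 𝔰(δ) ⊕ 𝔰(δ')`, where `δ ⊕ δ' ∈ 𝔼(Z ⊞ Z', A ⊞ A')` is the extension whose
  components are `δ`, `0`, `0`, `δ'`. -/
  realizes_biprod : ∀ {A B Z A' B' Z' : C} {δ : (E.obj (op Z)).obj A}
    {δ' : (E.obj (op Z')).obj A'} {x : A ⟶ B} {y : B ⟶ Z} {x' : A' ⟶ B'} {y' : B' ⟶ Z'},
    Realizes x y δ → Realizes x' y' δ' →
    Realizes (biprod.map x x') (biprod.map y y')
      ((E.obj (op (Z ⊞ Z'))).map (biprod.inl : A ⟶ A ⊞ A')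
          ((E.map (biprod.fst : Z ⊞ Z' ⟶ Z).op).app A δ) +
        (E.obj (op (Z ⊞ Z'))).map (biprod.inr : A' ⟶ A ⊞ A')
          ((E.map (biprod.snd : Z ⊞ Z' ⟶ Z').op).app A' δ'))
  /-- (ET3) -/
  et3 : ∀ {A B Z A' B' Z' : C} {δ : (E.obj (op Z)).obj A}
    {δ' : (E.obj (op Z')).obj A'} {x : A ⟶ B} {y : B ⟶ Z} {x' : A' ⟶ B'} {y' : B' ⟶ Z'},
    Realizes x y δ → Realizes x' y' δ' →
    ∀ (a : A ⟶ A') (b : B ⟶ B'), x ≫ b = a ≫ x' →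
      ∃ c : Z ⟶ Z', y ≫ c = b ≫ y' ∧
        (E.obj (op Z)).map a δ = (E.map c.op).app A' δ'
  /-- (ET3)ᵒᵖ -/
  et3_op : ∀ {A B Z A' B' Z' : C} {δ : (E.obj (op Z)).obj A}
    {δ' : (E.obj (op Z')).obj A'} {x : A ⟶ B} {y : B ⟶ Z} {x' : A' ⟶ B'} {y' : B' ⟶ Z'},
    Realizes x y δ → Realizes x' y' δ' →
    ∀ (b : B ⟶ B') (c : Z ⟶ Z'), y ≫ c = b ≫ y' →
      ∃ a : A ⟶ A', x ≫ b = a ≫ x' ∧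
        (E.obj (op Z)).map a δ = (E.map c.op).app A' δ'
  /-- (ET4) -/
  et4 : ∀ {A B D Z F : C} {δ : (E.obj (op D)).obj A} {δ' : (E.obj (op F)).obj B}
    {f : A ⟶ B} {f' : B ⟶ D} {g : B ⟶ Z} {g' : Z ⟶ F},
    Realizes f f' δ → Realizes g g' δ' →
    ∃ (M : C) (h' : Z ⟶ M) (d : D ⟶ M) (e : M ⟶ F) (δ'' : (E.obj (op M)).obj A),
      Realizes (f ≫ g) h' δ'' ∧ f' ≫ d = g ≫ h' ∧ h' ≫ e = g' ∧
      Realizes d e ((E.obj (op F)).map f' δ') ∧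
      (E.map d.op).app A δ'' = δ ∧
      (E.obj (op M)).map f δ'' = (E.map e.op).app B δ'
  /-- (ET4)ᵒᵖ -/
  et4_op : ∀ {A B D Z F : C} {δ : (E.obj (op A)).obj D} {δ' : (E.obj (op B)).obj F}
    {f' : D ⟶ B} {f : B ⟶ A} {g' : F ⟶ Z} {g : Z ⟶ B},
    Realizes f' f δ → Realizes g' g δ' →
    ∃ (M : C) (h' : M ⟶ Z) (d : M ⟶ D) (e : F ⟶ M) (δ'' : (E.obj (op A)).obj M),
      Realizes h' (g ≫ f) δ'' ∧ d ≫ f' = h' ≫ g ∧ e ≫ h' = g' ∧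
      Realizes e d ((E.map f'.op).app F δ') ∧
      (E.obj (op A)).map d δ'' = δ ∧
      (E.map f.op).app M δ'' = (E.obj (op B)).map e δ'

/-- An additive category is Krull–Schmidt if every object is a finite direct sum of objects with
local endomorphism rings. -/
def IsKrullSchmidtCategory (C : Type u) [Category.{v} C] [Preadditive C]
    [HasFiniteBiproducts C] : Prop :=
  ∀ X : C, ∃ (n : ℕ) (Y : Fin n → C), (∀ i, IsLocalRing (End (Y i))) ∧ Nonempty (X ≅ ⨁ Y)

/-- The (object class of a) full additive subcategory of an additive category that is closed under
isomorphisms and direct summands. -/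
structure IsAdditiveSubcategory {C : Type u} [Category.{v} C] [Preadditive C]
    [HasFiniteBiproducts C] (P : ObjectProperty C) : Prop where
  iso : ∀ {X Y : C}, (X ≅ Y) → P X → P Y
  zero : ∀ {X : C}, IsZero X → P X
  biprod : ∀ {X Y : C}, P X → P Y → P (X ⊞ Y)
  summand : ∀ {X Y : C}, P (X ⊞ Y) → P X

namespace ExtriangulatedStructure

variable {C : Type u} [Category.{v} C] [Preadditive C] [HasFiniteBiproducts C]
  (S : ExtriangulatedStructure.{w} C)

/-- `A ⟶ B ⟶ Z` is a conflation, i.e. part of an `𝔼`-triangle `A ⟶ B ⟶ Z ⇢`. -/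
def IsConflation {A B Z : C} (x : A ⟶ B) (y : B ⟶ Z) : Prop :=
  ∃ δ : (S.E.obj (op Z)).obj A, S.Realizes x y δ

def IsInflation {A B : C} (x : A ⟶ B) : Prop :=
  ∃ (Z : C) (y : B ⟶ Z), S.IsConflation x y

def IsDeflation {B Z : C} (y : B ⟶ Z) : Prop :=
  ∃ (A : C) (x : A ⟶ B), S.IsConflation x y

/-- There is an `𝔼`-triangle `A ⟶ B ⟶ Z ⇢` on the objects `A`, `B`, `Z`. -/
def HasTriangle (A B Z : C) : Prop :=
  ∃ (x : A ⟶ B) (y : B ⟶ Z), S.IsConflation x y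

def IsProjective (P : C) : Prop :=
  ∀ {A B Z : C} (x : A ⟶ B) (y : B ⟶ Z), S.IsConflation x y →
    ∀ c : P ⟶ Z, ∃ b : P ⟶ B, b ≫ y = c

def IsInjective (I : C) : Prop :=
  ∀ {A B Z : C} (x : A ⟶ B) (y : B ⟶ Z), S.IsConflation x y →
    ∀ a : A ⟶ I, ∃ b : B ⟶ I, x ≫ b = a

class EnoughProjectives : Prop where
  exists_triangle : ∀ Z : C, ∃ K P : C, S.IsProjective P ∧ S.HasTriangle K P Z

class EnoughInjectives : Prop where
  exists_triangle : ∀ A : C, ∃ I K : C, S.IsInjective I ∧ S.HasTriangle A I K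

/-- The WIC condition. -/
structure WIC : Prop where
  inflation : ∀ {X Y Z : C} (f : X ⟶ Y) (g : Y ⟶ Z), S.IsInflation (f ≫ g) → S.IsInflation f
  deflation : ∀ {X Y Z : C} (f : X ⟶ Y) (g : Y ⟶ Z), S.IsDeflation (f ≫ g) → S.IsDeflation g

/-- A chosen syzygy `Ω X`: there is an `𝔼`-triangle `Ω X ⟶ P ⟶ X ⇢` with `P` projective. -/
noncomputable def syzygy [S.EnoughProjectives] (X : C) : C :=
  (EnoughProjectives.exists_triangle (S := S) X).choose

/-- The iterated syzygy `Ωⁱ X`. -/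
noncomputable def iteratedSyzygy [S.EnoughProjectives] : ℕ → C → C
  | 0, X => X
  | i + 1, X => S.syzygy (iteratedSyzygy i X)

/-- The higher extension group `𝔼ⁱ⁺¹(X, Y) = 𝔼(Ωⁱ X, Y)`, for `i ≥ 0`. -/
noncomputable def extSucc [S.EnoughProjectives] (i : ℕ) (X Y : C) : AddCommGrpCat.{w} :=
  (S.E.obj (op (S.iteratedSyzygy i X))).obj Y

/-- `ω^⊥`: the objects `Y` with `𝔼ⁱ(X, Y) = 0` for all `i ≥ 1` and all `X` in `ω`. -/
def rightPerp [S.EnoughProjectives] (ω : ObjectProperty C) : ObjectProperty C :=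
  fun Y => ∀ X : C, ω X → ∀ i : ℕ, Subsingleton (S.extSucc i X Y)

def IsSelfOrthogonal [S.EnoughProjectives] (ω : ObjectProperty C) : Prop :=
  ω ≤ S.rightPerp ω

/-- `Presⁿ_{𝒯₂}(𝒯₁)`: the objects `X` with an `𝔼`-triangle sequence
`X' ⟶ Tₙ ⟶ ⋯ ⟶ T₁ ⟶ X`, `Tᵢ` in `𝒯₁`, `X'` in `𝒯₂`. Such a sequence is obtained by splicing
`𝔼`-triangles `Kᵢ ⟶ Tᵢ ⟶ Kᵢ₋₁ ⇢`, `1 ≤ i ≤ n`, with `K₀ = X` and `Kₙ = X'`. -/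
def Pres (𝒯₁ 𝒯₂ : ObjectProperty C) : ℕ → ObjectProperty C
  | 0 => 𝒯₂
  | n + 1 => fun X => ∃ K T : C, 𝒯₁ T ∧ Pres 𝒯₁ 𝒯₂ n K ∧ S.HasTriangle K T X

/-- `Copresⁿ_{𝒯₂}(𝒯₁)`: the objects `X` with an `𝔼`-triangle sequence
`X ⟶ T₁ ⟶ ⋯ ⟶ Tₙ ⟶ X'`, `Tᵢ` in `𝒯₁`, `X'` in `𝒯₂`. -/
def Copres (𝒯₁ 𝒯₂ : ObjectProperty C) : ℕ → ObjectProperty C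
  | 0 => 𝒯₂
  | n + 1 => fun X => ∃ T K : C, 𝒯₁ T ∧ Copres 𝒯₁ 𝒯₂ n K ∧ S.HasTriangle X T K

/-- `ω̂ₙ`: the objects `A` with an `𝔼`-triangle sequence `Wₙ ⟶ ⋯ ⟶ W₁ ⟶ W₀ ⟶ A`, all `Wᵢ` in `ω`
(so `ω̂₀ = ω`). -/
def hatN (ω : ObjectProperty C) : ℕ → ObjectProperty C
  | 0 => ω
  | n + 1 => fun A => ∃ K W : C, ω W ∧ hatN ω n K ∧ S.HasTriangle K W A

/-- `ω̌ₙ`: the objects `A` with an `𝔼`-triangle sequence `A ⟶ W⁰ ⟶ W¹ ⟶ ⋯ ⟶ Wⁿ`, all `Wⁱ` in `ω`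
(so `ω̌₀ = ω`). -/
def checkN (ω : ObjectProperty C) : ℕ → ObjectProperty C
  | 0 => ω
  | n + 1 => fun A => ∃ W K : C, ω W ∧ checkN ω n K ∧ S.HasTriangle A W K

/-- `ω̂ = ⋃ₙ ω̂ₙ`. -/
def hat (ω : ObjectProperty C) : ObjectProperty C := fun A => ∃ n : ℕ, S.hatN ω n A

/-- `ω̌ = ⋃ₙ ω̌ₙ`. -/
def check (ω : ObjectProperty C) : ObjectProperty C := fun A => ∃ n : ℕ, S.checkN ω n A

/-- `_ω𝒳`: the objects `A` with an `𝔼`-triangle sequence `⋯ ⟶ W₂ ⟶ W₁ ⟶ W₀ ⟶ A`, spliced from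
`𝔼`-triangles `Kᵢ₊₁ ⟶ Wᵢ ⟶ Kᵢ ⇢` with `K₀ = A`, all `Wᵢ` in `ω` and all `Kᵢ` in `ω^⊥`. -/
def leftX [S.EnoughProjectives] (ω : ObjectProperty C) : ObjectProperty C :=
  fun A => ∃ K W : ℕ → C, K 0 = A ∧
    ∀ i : ℕ, ω (W i) ∧ S.rightPerp ω (K i) ∧ S.HasTriangle (K (i + 1)) (W i) (K i)

/-- `ω-dim M`, the least `n` with `M` in `ω̂ₙ` (and `⊤` if there is none). -/
noncomputable def dim (ω : ObjectProperty C) (M : C) : ℕ∞ :=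
  ⨅ (n : ℕ) (_ : S.hatN ω n M), (n : ℕ∞)

/-- `ω-dim 𝒯`, the least upper bound of `ω-dim M` for `M` in `𝒯`. -/
noncomputable def dimSubcategory (ω 𝒯 : ObjectProperty C) : ℕ∞ :=
  ⨆ (M : C) (_ : 𝒯 M), S.dim ω M

structure IsTiltingPair [S.EnoughProjectives] (𝒞 𝒯 : ObjectProperty C) : Prop where
  selfOrthogonal_left : S.IsSelfOrthogonal 𝒞
  selfOrthogonal_right : S.IsSelfOrthogonal 𝒯
  le_hat : 𝒯 ≤ S.hat 𝒞
  le_check : 𝒞 ≤ S.check 𝒯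

structure IsNTiltingPair [S.EnoughProjectives] (n : ℕ) (𝒞 𝒯 : ObjectProperty C) : Prop
    extends S.IsTiltingPair 𝒞 𝒯 where
  dim_le : S.dimSubcategory 𝒞 𝒯 ≤ n

/-- `g : W ⟶ Z` is a right `ω`-approximation of `Z`. -/
structure IsRightApproximation (ω : ObjectProperty C) {W Z : C} (g : W ⟶ Z) : Prop where
  mem : ω W
  factors : ∀ {W' : C}, ω W' → ∀ h : W' ⟶ Z, ∃ k : W' ⟶ W, k ≫ g = h

/-- Every object `Z` of the category has an `𝔼`-triangle `K ⟶ W ⟶ Z ⇢` whose second map is a right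
`ω`-approximation of `Z`. -/
def IsStronglyContravariantlyFinite (ω : ObjectProperty C) : Prop :=
  ∀ Z : C, ∃ (K W : C) (f : K ⟶ W) (g : W ⟶ Z),
    S.IsConflation f g ∧ IsRightApproximation ω g

end ExtriangulatedStructure

/-! Write `𝒬 = 𝒯^⊥ ∩ _𝒞𝒳`. Everything is dimension shifting plus splitting of triangles whose
extension group vanishes; `_𝒞𝒳` is closed under extensions, cones, summands, and those kernels that
lie in `𝒞^⊥`.

For a tilting pair, an `n`-step `𝒯`-presentation shifts `𝔼ⁱ(M, A)`, `M ∈ 𝒯`, to degree `i + n`,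
where it dies because `M` has `𝒞`-dimension at most `n` (`Pres_leftX_le_of_isNTiltingPair`).
Conversely, objects of `𝒬` are presented by iterated `𝒯`-approximations, whose kernels stay in `𝒬`
because `𝒞 ⊆ 𝒯̌` (`le_Pres_leftX_of_isTiltingPair`).

Now assume the equality. Then `𝒯 ⊆ 𝒬`, and every object of `𝒬` is covered by `𝒯` with kernel in `𝒬`
(`exists_triangle_of_Pres_leftX_eq`). The coresolution of `W ∈ 𝒞` therefore has its last term in
`𝒬`, and replacing its terms by objects of `𝒯` gives `K → F → W` with `F ∈ 𝒯̌ₙ`, `K ∈ 𝒬`. This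
splits, forcing `K ∈ 𝒯` and `W ∈ 𝒯̌ₙ` (`le_checkN_of_Pres_leftX_eq`). Finally each `A ∈ _𝒞𝒳` is a
quotient of an object of `𝒯̌ₙ` by one of `𝒬` (`exists_Pres_checkN_triangle`), so `𝔼ⁿ⁺¹(𝒯, A) = 0`,
which bounds the `𝒞`-dimension of `𝒯` by `n` (`hatN_of_extVanishes`). -/

lemma isIso_of_isIso_comp {C : Type u} [Category.{v} C] {X Y : C} (f : X ⟶ Y) (g : Y ⟶ X)
    [IsIso (f ≫ g)] [IsIso (g ≫ f)] :
    IsIso f := by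
  have h1 : f ≫ (g ≫ inv (f ≫ g)) = 𝟙 X := by rw [← Category.assoc, IsIso.hom_inv_id]
  have h2 : (inv (g ≫ f) ≫ g) ≫ f = 𝟙 Y := by rw [Category.assoc, IsIso.inv_hom_id]
  have : IsSplitMono f := ⟨⟨⟨_, h1⟩⟩⟩
  have : IsSplitEpi f := ⟨⟨⟨_, h2⟩⟩⟩
  exact isIso_of_mono_of_isSplitEpi f

/-! ### Functoriality of `𝔼`. -/

namespace ExtriangulatedStructure

open scoped ZeroObject

variable {C : Type u} [Category.{v} C] [Preadditive C] [HasFiniteBiproducts C]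
  (S : ExtriangulatedStructure.{w} C)

/-- The group `𝔼(Z, A)`. -/
abbrev Ext (Z A : C) : Type w := (S.E.obj (op Z)).obj A

/-- The pushforward `a_* : 𝔼(Z, A) → 𝔼(Z, A')`. -/
def push {A A' : C} (a : A ⟶ A') (Z : C) : S.Ext Z A →+ S.Ext Z A' :=
  ((S.E.obj (op Z)).map a).hom

/-- The pullback `c^* : 𝔼(Z', A) → 𝔼(Z, A)`. -/
def pull {Z Z' : C} (c : Z ⟶ Z') (A : C) : S.Ext Z' A →+ S.Ext Z A :=
  ((S.E.map c.op).app A).hom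

variable {S}

lemma push_id (A Z : C) (δ : S.Ext Z A) : S.push (𝟙 A) Z δ = δ := by
  simp [push]

lemma pull_id (A Z : C) (δ : S.Ext Z A) : S.pull (𝟙 Z) A δ = δ := by
  simp [pull]

lemma push_comp {A A' A'' : C} (a : A ⟶ A') (a' : A' ⟶ A'') (Z : C) (δ : S.Ext Z A) :
    S.push (a ≫ a') Z δ = S.push a' Z (S.push a Z δ) := by
  simp [push]

lemma pull_comp {Z Z' Z'' : C} (c : Z ⟶ Z') (c' : Z' ⟶ Z'') (A : C) (δ : S.Ext Z'' A) :
    S.pull (c ≫ c') A δ = S.pull c A (S.pull c' A δ) := by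
  simp [pull]

lemma push_pull {A A' Z Z' : C} (a : A ⟶ A') (c : Z ⟶ Z') (δ : S.Ext Z' A) :
    S.push a Z (S.pull c A δ) = S.pull c A' (S.push a Z' δ) := by
  have h := congrArg (fun f => f.hom δ) ((S.E.map c.op).naturality a)
  exact h.symm

lemma push_sub {A A' : C} (a a' : A ⟶ A') (Z : C) (δ : S.Ext Z A) :
    S.push (a - a') Z δ = S.push a Z δ - S.push a' Z δ := by
  have := S.additive_right (op Z)
  simp [push, (S.E.obj (op Z)).map_sub]

lemma pull_sub {Z Z' : C} (c c' : Z ⟶ Z') (A : C) (δ : S.Ext Z' A) :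
    S.pull (c - c') A δ = S.pull c A δ - S.pull c' A δ := by
  have := S.additive_left
  simp [pull, S.E.map_sub]

lemma push_zero (A A' Z : C) (δ : S.Ext Z A) : S.push (0 : A ⟶ A') Z δ = 0 := by
  have := S.additive_right (op Z)
  simp [push, (S.E.obj (op Z)).map_zero]

lemma pull_zero (A Z Z' : C) (δ : S.Ext Z' A) : S.pull (0 : Z ⟶ Z') A δ = 0 := by
  have := S.additive_left
  simp [pull, S.E.map_zero]

lemma subsingleton_ext_iff {Z A : C} : Subsingleton (S.Ext Z A) ↔ ∀ δ : S.Ext Z A, δ = 0 :=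
  subsingleton_iff_forall_eq 0

/-! ### Exact sequences attached to an `𝔼`-triangle. -/

section Basic

variable {A B D : C} {x : A ⟶ B} {y : B ⟶ D} {δ : S.Ext D A}

/-- This degenerate triangle and `realizes_zero_id` are test objects: comparing them with a given
triangle by (ET3) and its dual yields the exactness statements below. -/
lemma realizes_id_zero (A Z : C) (hZ : IsZero Z) :
    S.Realizes (𝟙 A) (0 : A ⟶ Z) (0 : S.Ext Z A) := by
  have h : (0 : A ⊞ Z ⟶ Z) = biprod.snd := hZ.eq_of_tgt _ _
  refine S.realizes_of_equiv (x := biprod.inl) (y := biprod.snd) (B := A ⊞ Z)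
    ⟨biprod.fst, biprod.inl, ?_, ?_⟩ ?_ ?_ (S.realizes_zero A Z)
  · ext
    · simp
    · exact hZ.eq_of_tgt _ _
    · exact hZ.eq_of_src _ _
    · exact hZ.eq_of_src _ _
  · simp
  · simp
  · exact hZ.eq_of_tgt _ _

lemma realizes_zero_id (A Z : C) (hA : IsZero A) :
    S.Realizes (0 : A ⟶ Z) (𝟙 Z) (0 : S.Ext Z A) := by
  refine S.realizes_of_equiv (x := biprod.inl) (y := biprod.snd) (B := A ⊞ Z)
    ⟨biprod.snd, biprod.inr, ?_, ?_⟩ ?_ ?_ (S.realizes_zero A Z)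
  · ext
    · exact hA.eq_of_src _ _
    · exact hA.eq_of_src _ _
    · exact hA.eq_of_tgt _ _
    · simp
  · simp
  · exact hA.eq_of_src _ _
  · simp

lemma Realizes.comp_eq_zero (h : S.Realizes x y δ) : x ≫ y = 0 := by
  obtain ⟨c, hc, -⟩ := S.et3 (realizes_id_zero (S := S) A _ (isZero_zero C)) h (𝟙 A) x rfl
  rw [← hc, zero_comp]

lemma Realizes.exists_desc (h : S.Realizes x y δ) {Z : C} (g : B ⟶ Z) (hg : x ≫ g = 0) :
    ∃ c : D ⟶ Z, y ≫ c = g := by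
  obtain ⟨c, hc, -⟩ := S.et3 h (realizes_zero_id (S := S) _ Z (isZero_zero C)) 0 g (by simp [hg])
  exact ⟨c, by simpa using hc⟩

lemma Realizes.exists_lift (h : S.Realizes x y δ) {Z : C} (g : Z ⟶ B) (hg : g ≫ y = 0) :
    ∃ a : Z ⟶ A, a ≫ x = g := by
  obtain ⟨a, ha, -⟩ := S.et3_op (realizes_id_zero (S := S) Z _ (isZero_zero C)) h g 0
    (by simp [hg])
  exact ⟨a, by simpa using ha.symm⟩

lemma Realizes.pull_eq_zero (h : S.Realizes x y δ) : S.pull y A δ = 0 := by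
  obtain ⟨a, -, ha⟩ := S.et3_op (realizes_zero_id (S := S) _ B (isZero_zero C)) h (𝟙 B) y rfl
  exact ha.symm.trans (map_zero _)

lemma Realizes.push_eq_zero (h : S.Realizes x y δ) : S.push x D δ = 0 := by
  obtain ⟨c, -, hc⟩ := S.et3 h (realizes_id_zero (S := S) B _ (isZero_zero C)) x (𝟙 B) rfl
  exact hc.trans (map_zero _)

lemma Realizes.exists_lift_of_pull (h : S.Realizes x y δ) {Z : C} (c : Z ⟶ D)
    (hc : S.pull c A δ = 0) : ∃ b : Z ⟶ B, b ≫ y = c := by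
  obtain ⟨b, -, hb⟩ := S.realizes_hom (S.realizes_zero A Z) h (𝟙 A) c
    ((map_zero (S.push (𝟙 A) Z)).trans hc.symm)
  exact ⟨biprod.inr ≫ b, by rw [Category.assoc, ← hb, biprod.inr_snd_assoc]⟩

lemma Realizes.exists_desc_of_push (h : S.Realizes x y δ) {Z : C} (a : A ⟶ Z)
    (ha : S.push a D δ = 0) : ∃ b : B ⟶ Z, x ≫ b = a := by
  obtain ⟨b, hb, -⟩ := S.realizes_hom h (S.realizes_zero Z D) a (𝟙 D)
    (ha.trans (map_zero (S.pull (𝟙 D) Z)).symm)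
  exact ⟨b ≫ biprod.fst, by rw [← Category.assoc, hb, Category.assoc, biprod.inl_fst,
    Category.comp_id]⟩

/-- Exactness at `𝔼(Z, B)` needs (ET4): it realizes `y_* ξ = 0` by a split triangle `D → M → Z`, and
pulling `δ''` back along a section gives the preimage. -/
lemma Realizes.exists_push_eq (h : S.Realizes x y δ) {Z : C} (ξ : S.Ext Z B)
    (hξ : S.push y Z ξ = 0) : ∃ ζ : S.Ext Z A, S.push x Z ζ = ξ := by
  obtain ⟨F, g, g', hg⟩ := S.exists_realizes ξ
  obtain ⟨M, h', d, e, δ'', -, -, -, hde, -, h2⟩ := S.et4 h hg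
  obtain ⟨s, hs⟩ := Realizes.exists_lift_of_pull hde (𝟙 Z)
    ((pull_id _ _ _).trans hξ)
  refine ⟨S.pull s A δ'', ?_⟩
  have h3 : S.push x M δ'' = S.pull e B ξ := h2
  rw [push_pull, h3, ← pull_comp, hs, pull_id]

lemma Realizes.exists_eq_push (h : S.Realizes x y δ) {Z : C} (ξ : S.Ext D Z)
    (hξ : S.pull y Z ξ = 0) : ∃ f : A ⟶ Z, S.push f D δ = ξ := by
  obtain ⟨F, g', g, hg⟩ := S.exists_realizes ξ
  obtain ⟨b, hb⟩ := Realizes.exists_lift_of_pull hg y hξ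
  obtain ⟨a, -, ha⟩ := S.et3_op h hg b (𝟙 D) (by rw [Category.comp_id, hb])
  exact ⟨a, ha.trans (pull_id _ _ _)⟩

lemma Realizes.exists_eq_pull (h : S.Realizes x y δ) {Z : C} (ξ : S.Ext Z A)
    (hξ : S.push x Z ξ = 0) : ∃ f : Z ⟶ D, S.pull f A δ = ξ := by
  obtain ⟨F, g, g', hg⟩ := S.exists_realizes ξ
  obtain ⟨b, hb⟩ := Realizes.exists_desc_of_push hg x hξ
  obtain ⟨c, -, hc⟩ := S.et3 hg h (𝟙 A) b (by rw [Category.id_comp, hb])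
  exact ⟨c, hc.symm.trans (push_id _ _ _)⟩

/-- Endomorphisms of the middle term of an `𝔼`-triangle inducing identities on the ends are
isomorphisms. -/
lemma Realizes.isIso_of_comp (h : S.Realizes x y δ) (b : B ⟶ B) (h1 : x ≫ b = x)
    (h2 : b ≫ y = y) : IsIso b := by
  obtain ⟨t, ht⟩ := h.exists_desc (b - 𝟙 B) (by simp [h1])
  obtain ⟨s, hs⟩ := h.exists_lift (b - 𝟙 B) (by simp [h2])
  have hsq : (b - 𝟙 B) ≫ (b - 𝟙 B) = 0 := by
    calc (b - 𝟙 B) ≫ (b - 𝟙 B) = (s ≫ x) ≫ (y ≫ t) := by rw [hs, ht]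
      _ = s ≫ (x ≫ y) ≫ t := by simp only [Category.assoc]
      _ = 0 := by rw [h.comp_eq_zero]; simp
  have hbb : b ≫ b = b + b - 𝟙 B := by
    simp only [Preadditive.sub_comp, Preadditive.comp_sub, Category.comp_id,
      Category.id_comp] at hsq
    rw [← sub_eq_zero, ← hsq]; abel
  -- Since `b - 1` squares to zero, `b` has inverse `1 - (b - 1)`.
  refine ⟨𝟙 B + 𝟙 B - b, ?_, ?_⟩ <;>
  · simp only [Preadditive.sub_comp, Preadditive.comp_sub, Preadditive.add_comp,
      Preadditive.comp_add, Category.comp_id, Category.id_comp, hbb]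
    abel

/-- Realize the transported extension and lift the isomorphisms of the ends in both directions; both
composites of the middle maps are invertible by `isIso_of_comp`. -/
lemma Realizes.of_iso_ends (h : S.Realizes x y δ) {A' D' : C} (a : A ≅ A') (d : D ≅ D') :
    S.Realizes (a.inv ≫ x) (y ≫ d.hom) (S.push a.hom D' (S.pull d.inv A δ)) := by
  obtain ⟨B', x', y', h'⟩ := S.exists_realizes (S.push a.hom D' (S.pull d.inv A δ))
  obtain ⟨b, hb1, hb2⟩ := S.realizes_hom h h' a.hom d.hom (by
    change S.push a.hom D δ = S.pull d.hom A' (S.push a.hom D' (S.pull d.inv A δ))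
    rw [← push_pull, ← pull_comp, d.hom_inv_id, pull_id])
  obtain ⟨b', hb1', hb2'⟩ := S.realizes_hom h' h a.inv d.inv (by
    change S.push a.inv D' (S.push a.hom D' (S.pull d.inv A δ)) = S.pull d.inv A δ
    rw [← push_comp, a.hom_inv_id, push_id])
  have i1 : IsIso (b ≫ b') := Realizes.isIso_of_comp h _
    (by rw [← Category.assoc, hb1, Category.assoc, hb1', a.hom_inv_id_assoc])
    (by rw [Category.assoc, ← hb2', ← Category.assoc, ← hb2, Category.assoc, d.hom_inv_id,
      Category.comp_id])
  have i2 : IsIso (b' ≫ b) := Realizes.isIso_of_comp h' _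
    (by rw [← Category.assoc, hb1', Category.assoc, hb1, a.inv_hom_id_assoc])
    (by rw [Category.assoc, ← hb2, ← Category.assoc, ← hb2', Category.assoc, d.inv_hom_id,
      Category.comp_id])
  have : IsIso b := isIso_of_isIso_comp b b'
  refine S.realizes_of_equiv (asIso b).symm ?_ ?_ h'
  · rw [Iso.symm_hom, asIso_inv, IsIso.comp_inv_eq, Category.assoc, hb1, a.inv_hom_id_assoc]
  · rw [Iso.symm_hom, asIso_inv, IsIso.inv_comp_eq, hb2]

lemma realizes_zero_of_splitting {s : D ⟶ B} {r : B ⟶ A} (hxr : x ≫ r = 𝟙 A)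
    (hsy : s ≫ y = 𝟙 D) (hsr : s ≫ r = 0) (hxy : x ≫ y = 0) (h : r ≫ x + y ≫ s = 𝟙 B) :
    S.Realizes s r (0 : S.Ext A D) := by
  refine S.realizes_of_equiv (b := ⟨biprod.desc s x, biprod.lift y r, ?_, ?_⟩) ?_ ?_
    (S.realizes_zero D A)
  · ext <;> simp [hsy, hsr, hxy, hxr]
  · simp [← h, add_comm]
  · simp
  · ext <;> simp [hsr, hxr]

/-- A retraction of the inflation of a split `𝔼`-triangle is the deflation of a split
`𝔼`-triangle with the ends exchanged. -/
lemma Realizes.exists_section (h : S.Realizes x y (0 : S.Ext D A)) (r : B ⟶ A)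
    (hr : x ≫ r = 𝟙 A) : ∃ s : D ⟶ B, S.Realizes s r (0 : S.Ext A D) := by
  obtain ⟨s₀, hs₀⟩ := Realizes.exists_lift_of_pull h (𝟙 D) (map_zero _)
  obtain ⟨s, hs⟩ := h.exists_desc (𝟙 B - r ≫ x) (by simp [reassoc_of% hr])
  have hxy : x ≫ y = 0 := h.comp_eq_zero
  have hs' : s = s₀ - s₀ ≫ r ≫ x := by
    rw [← Category.id_comp s, ← hs₀, Category.assoc, hs]; simp
  exact ⟨s, realizes_zero_of_splitting hr (by rw [hs']; simp [hs₀, hxy])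
    (by rw [hs']; simp [hr]) hxy (by rw [hs]; abel)⟩

/-- A section of the deflation of a split `𝔼`-triangle is the inflation of a split
`𝔼`-triangle with the ends exchanged. -/
lemma Realizes.exists_retraction (h : S.Realizes x y (0 : S.Ext D A)) (s : D ⟶ B)
    (hs : s ≫ y = 𝟙 D) : ∃ r : B ⟶ A, S.Realizes s r (0 : S.Ext A D) := by
  obtain ⟨r₀, hr₀⟩ := Realizes.exists_desc_of_push h (𝟙 A) (map_zero _)
  obtain ⟨r, hr⟩ := h.exists_lift (𝟙 B - y ≫ s) (by simp [hs])
  have hxy : x ≫ y = 0 := h.comp_eq_zero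
  have hr' : r = r₀ - y ≫ s ≫ r₀ := by
    rw [← Category.comp_id r, ← hr₀, ← Category.assoc, hr]; simp
  exact ⟨r, realizes_zero_of_splitting (by rw [hr']; simp [hr₀, reassoc_of% hxy]) hs
    (by rw [hr']; simp [reassoc_of% hs]) hxy (by rw [hr]; abel)⟩

lemma Realizes.nonempty_iso_of_zero (h : S.Realizes x y (0 : S.Ext D A)) :
    Nonempty (B ≅ A ⊞ D) := by
  obtain ⟨b, -, -⟩ := S.equiv_of_realizes h (S.realizes_zero A D)
  exact ⟨b⟩

end Basic

/-! ### Composition, pullback and pushout of triangles. -/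

section Triangle

variable {A B D A' B' D' : C}

lemma HasTriangle.of_iso (h : S.HasTriangle A B D) (a : A ≅ A') (b : B ≅ B') (d : D ≅ D') :
    S.HasTriangle A' B' D' := by
  obtain ⟨x, y, δ, h⟩ := h
  exact ⟨_, _, _, S.realizes_of_equiv b rfl (Iso.hom_inv_id_assoc _ _)
    (Realizes.of_iso_ends h a d)⟩

lemma HasTriangle.biprod (h : S.HasTriangle A B D) (h' : S.HasTriangle A' B' D') :
    S.HasTriangle (A ⊞ A') (B ⊞ B') (D ⊞ D') := by
  obtain ⟨x, y, δ, h⟩ := h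
  obtain ⟨x', y', δ', h'⟩ := h'
  exact ⟨_, _, _, S.realizes_biprod h h'⟩

variable (S) in
lemma hasTriangle_split (A D : C) : S.HasTriangle A (A ⊞ D) D :=
  ⟨_, _, _, S.realizes_zero A D⟩

variable (S) in
lemma hasTriangle_id_zero (A : C) {Z : C} (hZ : IsZero Z) : S.HasTriangle A A Z :=
  ⟨_, _, _, realizes_id_zero A _ hZ⟩

variable (S) in
lemma hasTriangle_zero_id (A : C) {Z : C} (hZ : IsZero Z) : S.HasTriangle Z A A :=
  ⟨_, _, _, realizes_zero_id _ A hZ⟩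

lemma HasTriangle.nonempty_iso (h : S.HasTriangle A B D) (h0 : Subsingleton (S.Ext D A)) :
    Nonempty (B ≅ A ⊞ D) := by
  obtain ⟨x, y, δ, h⟩ := h
  obtain rfl : δ = 0 := Subsingleton.elim _ _
  exact Realizes.nonempty_iso_of_zero h

lemma HasTriangle.comp_inflation {Z F : C} (h : S.HasTriangle A B D) (h' : S.HasTriangle B Z F) :
    ∃ M, S.HasTriangle A Z M ∧ S.HasTriangle D M F := by
  obtain ⟨x, y, δ, h⟩ := h
  obtain ⟨x', y', δ', h'⟩ := h'
  obtain ⟨M, h', d, e, δ'', h1, -, -, h2, -⟩ := S.et4 h h'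
  exact ⟨M, ⟨_, _, _, h1⟩, ⟨_, _, _, h2⟩⟩

lemma HasTriangle.comp_deflation {Z F : C} (h : S.HasTriangle F Z B) (h' : S.HasTriangle A B D) :
    ∃ M, S.HasTriangle M Z D ∧ S.HasTriangle F M A := by
  obtain ⟨x, y, δ, h⟩ := h
  obtain ⟨x', y', δ', h'⟩ := h'
  obtain ⟨M, h', d, e, δ'', h1, -, -, h2, -⟩ := S.et4_op h' h
  exact ⟨M, ⟨_, _, _, h1⟩, ⟨_, _, _, h2⟩⟩

/-- The pullback of two deflations with the same target. -/
lemma HasTriangle.pullback {A₁ B₁ A₂ B₂ : C} (h₁ : S.HasTriangle A₁ B₁ D)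
    (h₂ : S.HasTriangle A₂ B₂ D) :
    ∃ M, S.HasTriangle A₁ M B₂ ∧ S.HasTriangle A₂ M B₁ := by
  obtain ⟨x₁, y₁, δ₁, h₁⟩ := h₁
  obtain ⟨x₂, y₂, δ₂, h₂⟩ := h₂
  obtain ⟨M, m, p, hM⟩ := S.exists_realizes (S.pull y₂ A₁ δ₁)
  obtain ⟨N, k, d, e, ξ, hN, -, -, hed, hd, he⟩ := S.et4_op h₂ hM
  have hed0 : S.Realizes e d (0 : S.Ext A₂ A₁) := by
    have h0 : S.pull x₂ A₁ (S.pull y₂ A₁ δ₁) = 0 := by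
      rw [← pull_comp, Realizes.comp_eq_zero h₂, pull_zero]
    rw [← h0]; exact hed
  obtain ⟨r₀, hr₀⟩ := Realizes.exists_desc_of_push hed0 (𝟙 A₁) (map_zero _)
  replace he : S.pull y₂ N ξ = S.push e B₂ (S.pull y₂ A₁ δ₁) := he
  replace hd : S.push d D ξ = δ₂ := hd
  -- An arbitrary retraction `r₀` sends `ξ` to `δ₁` only up to a pushforward of `δ₂`; subtracting `d
  -- ≫ f` corrects this, so that (ET4) recovers exactly `δ₁` and hence `B₁`.
  obtain ⟨f, hf⟩ := Realizes.exists_eq_push h₂ (S.push r₀ D ξ - δ₁) (by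
    rw [map_sub, ← push_pull, he, ← push_comp, hr₀, push_id, sub_self])
  have hr : e ≫ (r₀ - d ≫ f) = 𝟙 A₁ := by
    rw [Preadditive.comp_sub, hr₀, ← Category.assoc, Realizes.comp_eq_zero hed0]; simp
  have hrξ : S.push (r₀ - d ≫ f) D ξ = δ₁ := by
    rw [push_sub, push_comp, hd, hf, sub_sub_cancel]
  obtain ⟨s, hs⟩ := Realizes.exists_section hed0 _ hr
  obtain ⟨B', h', d', e', δ', h3, -, -, h4, -⟩ := S.et4 hs hN
  have h5 : S.Realizes d' e' δ₁ := by rw [← hrξ]; exact h4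
  obtain ⟨b, -, -⟩ := S.equiv_of_realizes h5 h₁
  exact ⟨M, ⟨_, _, _, hM⟩, HasTriangle.of_iso ⟨_, _, _, h3⟩ (Iso.refl _) (Iso.refl _) b⟩

/-- The pushout of two inflations with the same source. -/
lemma HasTriangle.pushout {B₁ D₁ B₂ D₂ : C} (h₁ : S.HasTriangle A B₁ D₁)
    (h₂ : S.HasTriangle A B₂ D₂) :
    ∃ M, S.HasTriangle B₂ M D₁ ∧ S.HasTriangle B₁ M D₂ := by
  obtain ⟨x₁, y₁, δ₁, h₁⟩ := h₁
  obtain ⟨x₂, y₂, δ₂, h₂⟩ := h₂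
  obtain ⟨M, m, p, hM⟩ := S.exists_realizes (S.push x₂ D₁ δ₁)
  obtain ⟨N, k, d, e, ξ, hN, -, -, hde, hd, he⟩ := S.et4 h₂ hM
  have hde0 : S.Realizes d e (0 : S.Ext D₁ D₂) := by
    have h0 : S.push y₂ D₁ (S.push x₂ D₁ δ₁) = 0 := by
      rw [← push_comp, Realizes.comp_eq_zero h₂, push_zero]
    rw [← h0]; exact hde
  replace he : S.push x₂ N ξ = S.pull e B₂ (S.push x₂ D₁ δ₁) := he
  replace hd : S.pull d A ξ = δ₂ := hd
  obtain ⟨s₀, hs₀⟩ := Realizes.exists_lift_of_pull hde0 (𝟙 D₁) (map_zero _)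
  obtain ⟨f, hf⟩ := Realizes.exists_eq_pull h₂ (S.pull s₀ A ξ - δ₁) (by
    rw [map_sub, push_pull, he, ← pull_comp, hs₀, pull_id, sub_self])
  have hs : (s₀ - f ≫ d) ≫ e = 𝟙 D₁ := by
    rw [Preadditive.sub_comp, hs₀, Category.assoc, Realizes.comp_eq_zero hde0]; simp
  have hsξ : S.pull (s₀ - f ≫ d) A ξ = δ₁ := by
    rw [pull_sub, pull_comp, hd, hf, sub_sub_cancel]
  obtain ⟨r, hr⟩ := Realizes.exists_retraction hde0 _ hs
  obtain ⟨B', h', d', e', δ', h3, -, -, h4, -⟩ := S.et4_op hr hN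
  have h5 : S.Realizes e' d' δ₁ := by rw [← hsξ]; exact h4
  obtain ⟨b, -, -⟩ := S.equiv_of_realizes h5 h₁
  exact ⟨M, ⟨_, _, _, hM⟩, HasTriangle.of_iso ⟨_, _, _, h3⟩ b (Iso.refl _) (Iso.refl _)⟩

end Triangle

/-! ### Vanishing in degree one and one-step dimension shifts. -/

section DegreeOne

variable {A B D X Y Z P I : C}

lemma IsProjective.ext_eq_zero (hP : S.IsProjective P) (δ : S.Ext P A) : δ = 0 := by
  obtain ⟨B, x, y, h⟩ := S.exists_realizes δ
  obtain ⟨b, hb⟩ := hP x y ⟨δ, h⟩ (𝟙 P)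
  rw [← pull_id A P δ, ← hb, pull_comp, Realizes.pull_eq_zero h, map_zero]

lemma IsInjective.ext_eq_zero (hI : S.IsInjective I) (δ : S.Ext Z I) : δ = 0 := by
  obtain ⟨B, x, y, h⟩ := S.exists_realizes δ
  obtain ⟨b, hb⟩ := hI x y ⟨δ, h⟩ (𝟙 I)
  rw [← push_id I Z δ, ← hb, push_comp, Realizes.push_eq_zero h, map_zero]

lemma HasTriangle.subsingleton_ext_middle_right (h : S.HasTriangle A B D)
    (hA : Subsingleton (S.Ext X A)) (hD : Subsingleton (S.Ext X D)) :
    Subsingleton (S.Ext X B) := by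
  obtain ⟨x, y, δ, h⟩ := h
  refine subsingleton_ext_iff.2 fun ξ => ?_
  obtain ⟨ζ, rfl⟩ := Realizes.exists_push_eq h ξ (Subsingleton.elim _ _)
  rw [Subsingleton.elim ζ 0, map_zero]

lemma subsingleton_ext_of_retract_left {X' : C} (i : X ⟶ X') (r : X' ⟶ X) (hir : i ≫ r = 𝟙 X)
    (h : Subsingleton (S.Ext X' Y)) : Subsingleton (S.Ext X Y) := by
  refine subsingleton_ext_iff.2 fun ξ => ?_
  rw [← pull_id _ _ ξ, ← hir, pull_comp, Subsingleton.elim (S.pull r Y ξ) 0, map_zero]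

lemma subsingleton_ext_of_retract_right {Y' : C} (i : Y ⟶ Y') (r : Y' ⟶ Y) (hir : i ≫ r = 𝟙 Y)
    (h : Subsingleton (S.Ext X Y')) : Subsingleton (S.Ext X Y) := by
  refine subsingleton_ext_iff.2 fun ξ => ?_
  rw [← push_id _ _ ξ, ← hir, push_comp, Subsingleton.elim (S.push i X ξ) 0, map_zero]

/-- The kernel of a deflation `y : B ⟶ D` is orthogonal to `X` if so is `B` and every morphism
from `X` to `D` factors through `y`. -/
lemma IsConflation.subsingleton_ext_of_factors {x : A ⟶ B} {y : B ⟶ D} (h : S.IsConflation x y)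
    (hB : Subsingleton (S.Ext X B)) (hy : ∀ c : X ⟶ D, ∃ b : X ⟶ B, b ≫ y = c) :
    Subsingleton (S.Ext X A) := by
  obtain ⟨δ, h⟩ := h
  refine subsingleton_ext_iff.2 fun ξ => ?_
  obtain ⟨f, rfl⟩ := Realizes.exists_eq_pull h ξ (Subsingleton.elim _ _)
  obtain ⟨b, rfl⟩ := hy f
  rw [pull_comp, Realizes.pull_eq_zero h, map_zero]

/-- An element of `𝔼(K, A)` is a pullback `f^* δ` with `f : K ⟶ D`; as `𝔼(X, D) = 0`, `f` extends to
`P`, so the element comes from `𝔼(P, A) = 0`. -/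
lemma HasTriangle.subsingleton_ext_syzygy_left {K : C} (h : S.HasTriangle A B D)
    (hK : S.HasTriangle K P X) (hP : S.IsProjective P) (hD : Subsingleton (S.Ext X D))
    (hB : Subsingleton (S.Ext K B)) : Subsingleton (S.Ext K A) := by
  obtain ⟨x, y, δ, h⟩ := h
  obtain ⟨k, p, κ, hk⟩ := hK
  refine subsingleton_ext_iff.2 fun ξ => ?_
  obtain ⟨f, rfl⟩ := Realizes.exists_eq_pull h ξ (Subsingleton.elim _ _)
  obtain ⟨g, rfl⟩ := Realizes.exists_desc_of_push hk f (Subsingleton.elim _ _)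
  rw [pull_comp, hP.ext_eq_zero (S.pull g A δ), map_zero]

lemma HasTriangle.subsingleton_ext_syzygy_right {K : C} (h : S.HasTriangle A B D)
    (hK : S.HasTriangle K P X) (hP : S.IsProjective P) (hB : Subsingleton (S.Ext X B))
    (hA : Subsingleton (S.Ext K A)) : Subsingleton (S.Ext X D) := by
  obtain ⟨x, y, δ, h⟩ := h
  obtain ⟨k, p, κ, hk⟩ := hK
  refine subsingleton_ext_iff.2 fun ξ => ?_
  obtain ⟨f, rfl⟩ := Realizes.exists_eq_push hk ξ (hP.ext_eq_zero _)
  obtain ⟨g, rfl⟩ := Realizes.exists_lift_of_pull h f (Subsingleton.elim _ _)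
  rw [push_comp, Subsingleton.elim (S.push g X κ) 0, map_zero]

lemma HasTriangle.subsingleton_ext_cosyzygy_left {L : C} (h : S.HasTriangle A B D)
    (hL : S.HasTriangle Y I L) (hI : S.IsInjective I) (hB : Subsingleton (S.Ext B Y))
    (hD : Subsingleton (S.Ext D L)) : Subsingleton (S.Ext A Y) := by
  obtain ⟨x, y, δ, h⟩ := h
  obtain ⟨k, p, κ, hk⟩ := hL
  refine subsingleton_ext_iff.2 fun ξ => ?_
  obtain ⟨f, rfl⟩ := Realizes.exists_eq_pull hk ξ (hI.ext_eq_zero _)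
  obtain ⟨g, rfl⟩ := Realizes.exists_desc_of_push h f (Subsingleton.elim _ _)
  rw [pull_comp, Subsingleton.elim (S.pull g Y κ) 0, map_zero]

lemma HasTriangle.subsingleton_ext_cosyzygy_right {L : C} (h : S.HasTriangle A B D)
    (hL : S.HasTriangle Y I L) (hI : S.IsInjective I) (hA : Subsingleton (S.Ext A Y))
    (hB : Subsingleton (S.Ext B L)) : Subsingleton (S.Ext D L) := by
  obtain ⟨x, y, δ, h⟩ := h
  obtain ⟨k, p, κ, hk⟩ := hL
  refine subsingleton_ext_iff.2 fun ξ => ?_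
  obtain ⟨f, rfl⟩ := Realizes.exists_eq_push h ξ (Subsingleton.elim _ _)
  obtain ⟨g, rfl⟩ := Realizes.exists_lift_of_pull hk f (Subsingleton.elim _ _)
  rw [push_comp, hI.ext_eq_zero (S.push g D δ), map_zero]

end DegreeOne

/-! ### Cosyzygies. -/

section Cosyzygy

variable [S.EnoughInjectives]

variable (S) in
/-- A chosen cosyzygy of `Y`. -/
noncomputable def cosyzygy (Y : C) : C :=
  (EnoughInjectives.exists_triangle (S := S) Y).choose_spec.choose

variable (S) in
lemma exists_cosyzygy_triangle (Y : C) :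
    ∃ I : C, S.IsInjective I ∧ S.HasTriangle Y I (S.cosyzygy Y) :=
  ⟨_, (EnoughInjectives.exists_triangle (S := S) Y).choose_spec.choose_spec⟩

end Cosyzygy

/-! ### Vanishing of higher extensions. -/

section Higher

variable [S.EnoughProjectives]

variable (S) in
/-- `𝔼ⁱ⁺¹(X, Y) = 0`. -/
abbrev ExtVanishes (i : ℕ) (X Y : C) : Prop := Subsingleton (S.Ext (S.iteratedSyzygy i X) Y)

variable (S) in
lemma exists_syzygy_triangle (X : C) :
    ∃ P : C, S.IsProjective P ∧ S.HasTriangle (S.syzygy X) P X :=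
  (EnoughProjectives.exists_triangle (S := S) X).choose_spec

variable {A B D X Y : C} {i : ℕ}

lemma HasTriangle.extVanishes_middle_right (h : S.HasTriangle A B D)
    (hA : S.ExtVanishes i X A) (hD : S.ExtVanishes i X D) : S.ExtVanishes i X B :=
  h.subsingleton_ext_middle_right hA hD

lemma HasTriangle.extVanishes_last_right (h : S.HasTriangle A B D)
    (hB : S.ExtVanishes i X B) (hA : S.ExtVanishes (i + 1) X A) : S.ExtVanishes i X D := by
  obtain ⟨P, hP, hK⟩ := S.exists_syzygy_triangle (S.iteratedSyzygy i X)
  exact h.subsingleton_ext_syzygy_right hK hP hB hA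

lemma HasTriangle.extVanishes_first_right (h : S.HasTriangle A B D)
    (hD : S.ExtVanishes i X D) (hB : S.ExtVanishes (i + 1) X B) : S.ExtVanishes (i + 1) X A := by
  obtain ⟨P, hP, hK⟩ := S.exists_syzygy_triangle (S.iteratedSyzygy i X)
  exact h.subsingleton_ext_syzygy_left hK hP hD hB

variable [S.EnoughInjectives]

lemma extVanishes_succ_iff : S.ExtVanishes (i + 1) X Y ↔ S.ExtVanishes i X (S.cosyzygy Y) := by
  obtain ⟨I, hI, h⟩ := S.exists_cosyzygy_triangle Y
  exact ⟨fun hY => h.extVanishes_last_right (subsingleton_ext_iff.2 hI.ext_eq_zero) hY,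
    fun hY => h.extVanishes_first_right hY (subsingleton_ext_iff.2 hI.ext_eq_zero)⟩

/-- Balancing: with the syzygies traded for cosyzygies, triangles in the first variable can be
handled by the degree-one lemmas. -/
lemma extVanishes_iff : S.ExtVanishes i X Y ↔ Subsingleton (S.Ext X (S.cosyzygy^[i] Y)) := by
  induction i generalizing Y with
  | zero => exact Iff.rfl
  | succ i ih => rw [extVanishes_succ_iff, ih, Function.iterate_succ_apply]

lemma HasTriangle.extVanishes_first_left (h : S.HasTriangle A B D)
    (hB : S.ExtVanishes i B Y) (hD : S.ExtVanishes (i + 1) D Y) : S.ExtVanishes i A Y := by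
  rw [extVanishes_iff] at *
  rw [Function.iterate_succ_apply'] at hD
  obtain ⟨I, hI, hL⟩ := S.exists_cosyzygy_triangle (S.cosyzygy^[i] Y)
  exact h.subsingleton_ext_cosyzygy_left hL hI hB hD

lemma HasTriangle.extVanishes_last_left (h : S.HasTriangle A B D)
    (hA : S.ExtVanishes i A Y) (hB : S.ExtVanishes (i + 1) B Y) : S.ExtVanishes (i + 1) D Y := by
  rw [extVanishes_iff] at *
  rw [Function.iterate_succ_apply'] at *
  obtain ⟨I, hI, hL⟩ := S.exists_cosyzygy_triangle (S.cosyzygy^[i] Y)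
  exact h.subsingleton_ext_cosyzygy_right hL hI hA hB

lemma ExtVanishes.of_retract_left {X' : C} (j : X ⟶ X') (r : X' ⟶ X) (hjr : j ≫ r = 𝟙 X)
    (h : S.ExtVanishes i X' Y) : S.ExtVanishes i X Y := by
  rw [extVanishes_iff] at *
  exact subsingleton_ext_of_retract_left j r hjr h

end Higher

/-! ### Orthogonal classes. -/

section Perp

variable [S.EnoughProjectives] {ω : ObjectProperty C} {A B D : C}

lemma rightPerp.middle (h : S.HasTriangle A B D) (hA : S.rightPerp ω A) (hD : S.rightPerp ω D) :
    S.rightPerp ω B :=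
  fun X hX i => h.extVanishes_middle_right (hA X hX i) (hD X hX i)

lemma rightPerp.last (h : S.HasTriangle A B D) (hA : S.rightPerp ω A) (hB : S.rightPerp ω B) :
    S.rightPerp ω D :=
  fun X hX i => h.extVanishes_last_right (hB X hX i) (hA X hX (i + 1))

lemma rightPerp.of_retract (hB : S.rightPerp ω B) (j : A ⟶ B) (r : B ⟶ A) (hjr : j ≫ r = 𝟙 A) :
    S.rightPerp ω A :=
  fun X hX i => subsingleton_ext_of_retract_right j r hjr (hB X hX i)

/-- The easy half of a Wakamatsu-type argument: degree one uses the factorization property, higher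
degrees shift to `D`. -/
lemma rightPerp.kernel_of_isRightApproximation {x : A ⟶ B} {y : B ⟶ D} (h : S.IsConflation x y)
    (hω : S.IsSelfOrthogonal ω) (hy : IsRightApproximation ω y) (hD : S.rightPerp ω D) :
    S.rightPerp ω A := by
  rintro X hX (_ | i)
  · exact h.subsingleton_ext_of_factors (hω B hy.mem X hX 0) fun c => hy.factors hX c
  · exact HasTriangle.extVanishes_first_right ⟨x, y, h⟩ (hD X hX i) (hω B hy.mem X hX (i + 1))

variable [S.EnoughInjectives]

lemma hatN.extVanishes {m i : ℕ} (hA : S.hatN ω m A) (hB : S.rightPerp ω B) (hi : m ≤ i) :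
    S.ExtVanishes i A B := by
  induction m generalizing A i with
  | zero => exact hB A hA i
  | succ m ih =>
    obtain ⟨K, W, hW, hK, h⟩ := hA
    obtain ⟨i, rfl⟩ := Nat.exists_eq_succ_of_ne_zero (by omega : i ≠ 0)
    exact h.extVanishes_last_left (ih hK (by omega)) (hB W hW _)

lemma checkN.extVanishes {m : ℕ} (hA : S.checkN ω m A) (hB : S.rightPerp ω B) (i : ℕ) :
    S.ExtVanishes i A B := by
  induction m generalizing A i with
  | zero => exact hB A hA i
  | succ m ih =>
    obtain ⟨W, K, hW, hK, h⟩ := hA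
    exact h.extVanishes_first_left (hB W hW i) (ih hK (i + 1))

lemma rightPerp_le_of_le_check {ω' : ObjectProperty C} (h : ω' ≤ S.check ω) :
    S.rightPerp ω ≤ S.rightPerp ω' := by
  intro Y hY X hX i
  obtain ⟨m, hm⟩ := h X hX
  exact hm.extVanishes hY i

end Perp

/-! ### Closure properties of `_ω𝒳`. -/

section LeftX

variable [S.EnoughProjectives] {ω : ObjectProperty C} {A B D : C}

/-- Coinduction for `_ω𝒳`: iterate a choice of `ω`-cover with kernel in `Q`. -/
lemma le_leftX_of_forall_exists {Q : ObjectProperty C} (hQ : Q ≤ S.rightPerp ω)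
    (h : ∀ A, Q A → ∃ K W, ω W ∧ Q K ∧ S.HasTriangle K W A) : Q ≤ S.leftX ω := by
  intro A hA
  choose! K W hW hK hT using h
  have hQn : ∀ i, Q (K^[i] A) := fun i => by
    induction i with
    | zero => exact hA
    | succ i ih => rw [Function.iterate_succ_apply']; exact hK _ ih
  refine ⟨fun i => K^[i] A, fun i => W (K^[i] A), rfl, fun i =>
    ⟨hW _ (hQn i), hQ _ (hQn i), ?_⟩⟩
  simp only [Function.iterate_succ_apply']
  exact hT _ (hQn i)

lemma leftX.rightPerp (hA : S.leftX ω A) : S.rightPerp ω A := by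
  obtain ⟨K, W, rfl, h⟩ := hA
  exact (h 0).2.1

lemma leftX.exists_triangle (hA : S.leftX ω A) :
    ∃ K W, ω W ∧ S.leftX ω K ∧ S.HasTriangle K W A := by
  obtain ⟨K, W, rfl, h⟩ := hA
  exact ⟨K 1, W 0, (h 0).1, ⟨fun i => K (i + 1), fun i => W (i + 1), rfl, fun i => h (i + 1)⟩,
    (h 0).2.2⟩

lemma leftX.of_triangle (hA : S.rightPerp ω A) {K W : C} (hW : ω W) (hK : S.leftX ω K)
    (h : S.HasTriangle K W A) : S.leftX ω A := by
  refine le_leftX_of_forall_exists (Q := fun X => S.leftX ω X ∨ X = A) ?_ ?_ A (Or.inr rfl)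
  · rintro X (hX | rfl)
    exacts [hX.rightPerp, hA]
  · rintro X (hX | rfl)
    · obtain ⟨K', W', hW', hK', h'⟩ := hX.exists_triangle
      exact ⟨K', W', hW', Or.inl hK', h'⟩
    · exact ⟨K, W, hW, Or.inl hK, h⟩

lemma leftX.of_iso (hA : S.leftX ω A) (e : A ≅ B) : S.leftX ω B := by
  obtain ⟨K, W, hW, hK, h⟩ := hA.exists_triangle
  exact .of_triangle (hA.rightPerp.of_retract e.inv e.hom e.inv_hom_id) hW hK
    (h.of_iso (Iso.refl _) (Iso.refl _) e)

lemma le_leftX (hω : IsAdditiveSubcategory ω) (hωo : S.IsSelfOrthogonal ω) : ω ≤ S.leftX ω :=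
  le_leftX_of_forall_exists hωo fun A hA =>
    ⟨0, A, hA, hω.zero (isZero_zero C), hasTriangle_zero_id S A (isZero_zero C)⟩

/-- A horseshoe argument: the pullback of `B` along `WD → D` splits as `A ⊞ WD`, is covered by `WA ⊞
WD`, and the resulting kernel over `B` is again an extension of `KD` by `KA`. -/
lemma leftX.middle (hω : IsAdditiveSubcategory ω) (h : S.HasTriangle A B D)
    (hA : S.leftX ω A) (hD : S.leftX ω D) : S.leftX ω B := by
  refine le_leftX_of_forall_exists
    (Q := fun B => ∃ A D, S.HasTriangle A B D ∧ S.leftX ω A ∧ S.leftX ω D) ?_ ?_ B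
    ⟨A, D, h, hA, hD⟩
  · rintro B ⟨A, D, h, hA, hD⟩
    exact rightPerp.middle h hA.rightPerp hD.rightPerp
  · rintro B ⟨A, D, h, hA, hD⟩
    obtain ⟨KA, WA, hWA, hKA, hTA⟩ := hA.exists_triangle
    obtain ⟨KD, WD, hWD, hKD, hTD⟩ := hD.exists_triangle
    obtain ⟨M, h₁, h₂⟩ := h.pullback hTD
    obtain ⟨e⟩ := h₁.nonempty_iso (hA.rightPerp WD hWD 0)
    have h₃ : S.HasTriangle KA (WA ⊞ WD) M :=
      (hTA.biprod (hasTriangle_zero_id S WD (isZero_zero C))).of_iso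
        (isoBiprodZero (isZero_zero C)).symm (Iso.refl _) e.symm
    obtain ⟨K, h₄, h₅⟩ := h₃.comp_deflation h₂
    exact ⟨K, WA ⊞ WD, hω.biprod hWA hWD, ⟨KA, KD, h₅, hKA, hKD⟩, h₄⟩

/-- Let `LA`, `LB` be the kernels of a cover `W → A ⊞ B` followed by the projections. Pulling the
cover back along `W ⊞ W → A ⊞ B` gives an object of `_ω𝒳` that splits as `(LA ⊞ LB) ⊞ W`, so `LA` is
again a summand of an object of `_ω𝒳`. -/
lemma leftX.of_biprod (hω : IsAdditiveSubcategory ω) (hωo : S.IsSelfOrthogonal ω)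
    (h : S.leftX ω (A ⊞ B)) : S.leftX ω A := by
  refine le_leftX_of_forall_exists (Q := fun A => ∃ B, S.leftX ω (A ⊞ B)) ?_ ?_ A ⟨B, h⟩
  · rintro A ⟨B, h⟩
    exact h.rightPerp.of_retract biprod.inl biprod.fst biprod.inl_fst
  · rintro A ⟨B, h⟩
    have hA : S.rightPerp ω A := h.rightPerp.of_retract biprod.inl biprod.fst biprod.inl_fst
    have hB : S.rightPerp ω B := h.rightPerp.of_retract biprod.inr biprod.snd biprod.inr_snd
    obtain ⟨K, W, hW, hK, hT⟩ := h.exists_triangle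
    have hAB : S.HasTriangle B (A ⊞ B) A :=
      (hasTriangle_split S B A).of_iso (Iso.refl _) (biprod.braiding _ _) (Iso.refl _)
    obtain ⟨LA, hLA, hLA'⟩ := hT.comp_deflation hAB
    obtain ⟨LB, hLB, hLB'⟩ := hT.comp_deflation (hasTriangle_split S A B)
    obtain ⟨E, h₁, h₂⟩ := hT.pullback (hLA.biprod hLB)
    have hE : S.leftX ω E := .middle hω h₁ hK (le_leftX hω hωo _ (hω.biprod hW hW))
    have hL : S.rightPerp ω (LA ⊞ LB) := rightPerp.middle (hasTriangle_split S LA LB)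
      (rightPerp.middle hLA' hK.rightPerp hB) (rightPerp.middle hLB' hK.rightPerp hA)
    obtain ⟨e⟩ := h₂.nonempty_iso (hL W hW 0)
    exact ⟨LA, W, hW, ⟨LB ⊞ W, hE.of_iso (e ≪≫ biprod.associator _ _ _)⟩, hLA⟩

lemma leftX.last (hω : IsAdditiveSubcategory ω) (h : S.HasTriangle A B D)
    (hA : S.leftX ω A) (hB : S.leftX ω B) : S.leftX ω D := by
  obtain ⟨K, W, hW, hK, hT⟩ := hB.exists_triangle
  obtain ⟨M, h₁, h₂⟩ := hT.comp_deflation h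
  exact .of_triangle (rightPerp.last h hA.rightPerp hB.rightPerp) hW (.middle hω h₂ hK hA) h₁

/-- The kernel `L` of `WB → D` is a summand of an extension of `WB` by `KD`, and `A` is the cone of
`KB → L`. -/
lemma leftX.first (hω : IsAdditiveSubcategory ω) (hωo : S.IsSelfOrthogonal ω)
    (h : S.HasTriangle A B D) (hB : S.leftX ω B) (hD : S.leftX ω D) (hA : S.rightPerp ω A) :
    S.leftX ω A := by
  obtain ⟨KB, WB, hWB, hKB, hTB⟩ := hB.exists_triangle
  obtain ⟨KD, WD, hWD, hKD, hTD⟩ := hD.exists_triangle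
  obtain ⟨L, hL, hL'⟩ := hTB.comp_deflation h
  obtain ⟨E, h₁, h₂⟩ := hTD.pullback hL
  have hE : S.leftX ω E := .middle hω h₁ hKD (le_leftX hω hωo _ hWB)
  obtain ⟨e⟩ := h₂.nonempty_iso (rightPerp.middle hL' hKB.rightPerp hA WD hWD 0)
  exact .last hω hL' hKB (.of_biprod hω hωo (hE.of_iso e))

lemma hat_le_leftX (hω : IsAdditiveSubcategory ω) (hωo : S.IsSelfOrthogonal ω) :
    S.hat ω ≤ S.leftX ω := by
  rintro A ⟨m, hA⟩
  induction m generalizing A with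
  | zero => exact le_leftX hω hωo A hA
  | succ m ih =>
    obtain ⟨K, W, hW, hK, h⟩ := hA
    exact .last hω h (ih K hK) (le_leftX hω hωo W hW)

lemma Pres_leftX_le (hω : IsAdditiveSubcategory ω) {𝒯 : ObjectProperty C}
    (h𝒯 : 𝒯 ≤ S.leftX ω) (m : ℕ) : S.Pres 𝒯 (S.leftX ω) m ≤ S.leftX ω := by
  induction m with
  | zero => exact le_rfl
  | succ m ih =>
    rintro A ⟨K, T, hT, hK, h⟩
    exact .last hω h (ih K hK) (h𝒯 T hT)

/-- An object of `_ω𝒳` from which the `(m + 1)`-st extensions to `_ω𝒳` vanish has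
`ω`-dimension at most `m`. -/
lemma hatN_of_extVanishes [S.EnoughInjectives] (hω : IsAdditiveSubcategory ω) {m : ℕ}
    (hA : S.leftX ω A) (h : ∀ Z, S.leftX ω Z → S.ExtVanishes m A Z) : S.hatN ω m A := by
  induction m generalizing A with
  | zero =>
    obtain ⟨K, W, hW, hK, hT⟩ := hA.exists_triangle
    obtain ⟨e⟩ := hT.nonempty_iso (h K hK)
    exact hω.summand (hω.iso (e ≪≫ biprod.braiding _ _) hW)
  | succ m ih =>
    obtain ⟨K, W, hW, hK, hT⟩ := hA.exists_triangle
    exact ⟨K, W, hW, ih hK fun Z hZ =>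
      hT.extVanishes_first_left (hZ.rightPerp W hW m) (h Z hZ), hT⟩

end LeftX

/-! ### Changing the terms of presentations and coresolutions. -/

section Pres

variable {𝓟 𝒬 𝒳 : ObjectProperty C} {A B D : C}

lemma Copres.mono_right {𝒳' : ObjectProperty C} (h : 𝒳 ≤ 𝒳') {m : ℕ} :
    S.Copres 𝓟 𝒳 m ≤ S.Copres 𝓟 𝒳' m := by
  induction m with
  | zero => exact h
  | succ m ih =>
    rintro A ⟨T, K, hT, hK, hA⟩
    exact ⟨T, K, hT, ih K hK, hA⟩

lemma Pres_zero_object (h𝓟 : ∀ Z : C, IsZero Z → 𝓟 Z) (h𝒳 : ∀ Z : C, IsZero Z → 𝒳 Z) (m : ℕ)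
    {Z : C} (hZ : IsZero Z) : S.Pres 𝓟 𝒳 m Z := by
  induction m with
  | zero => exact h𝒳 Z hZ
  | succ m ih => exact ⟨Z, Z, h𝓟 Z hZ, ih, hasTriangle_id_zero S Z hZ⟩

/-- Read backwards, each step of the coresolution lengthens the presentation of the next cosyzygy by
one. -/
lemma Copres.tail_mem {k m : ℕ} (hA : S.Pres 𝓟 𝒳 k A) (h : S.Copres 𝓟 ⊤ m A) :
    S.Copres 𝓟 (S.Pres 𝓟 𝒳 (k + m)) m A := by
  induction m generalizing k A with
  | zero => exact hA
  | succ m ih =>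
    obtain ⟨T, K, hT, hK, h⟩ := h
    refine ⟨T, K, hT, ?_, h⟩
    rw [add_comm m, ← add_assoc]
    exact ih ⟨A, T, hT, hA, h⟩ hK

lemma Pres.middle (h𝓟 : ∀ {A B D : C}, S.HasTriangle A B D → 𝓟 A → 𝓟 D → 𝓟 B)
    (h𝒳 : ∀ {A B D : C}, S.HasTriangle A B D → 𝒳 A → 𝒳 D → 𝒳 B) (hle : 𝓟 ≤ 𝒳) {m : ℕ}
    (h : S.HasTriangle A B D) (hA : 𝓟 A) (hD : S.Pres 𝓟 𝒳 m D) : S.Pres 𝓟 𝒳 m B := by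
  cases m with
  | zero => exact h𝒳 h (hle A hA) hD
  | succ m =>
    obtain ⟨K, P, hP, hK, hT⟩ := hD
    obtain ⟨M, h₁, h₂⟩ := h.pullback hT
    exact ⟨K, M, h𝓟 h₁ hA hP, hK, h₂⟩

/-- If `𝒬` generates `𝓟`, then `𝒬`-presentations may replace `𝓟`-presentations. -/
lemma Pres_le_Pres_of_generator
    (h𝓟 : ∀ {A B D : C}, S.HasTriangle A B D → 𝓟 A → 𝓟 D → 𝓟 B)
    (h𝒳 : ∀ {A B D : C}, S.HasTriangle A B D → 𝒳 A → 𝒳 D → 𝒳 B) (hle : 𝓟 ≤ 𝒳)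
    (hgen : ∀ A, 𝓟 A → ∃ K T, 𝒬 T ∧ 𝓟 K ∧ S.HasTriangle K T A) (m : ℕ) :
    S.Pres 𝓟 𝒳 m ≤ S.Pres 𝒬 𝒳 m := by
  induction m with
  | zero => exact le_rfl
  | succ m ih =>
    rintro A ⟨B, P, hP, hB, h⟩
    obtain ⟨K, T, hT, hK, h'⟩ := hgen P hP
    obtain ⟨N, h₁, h₂⟩ := h'.comp_deflation h
    exact ⟨N, T, hT, ih N (.middle h𝓟 h𝒳 hle h₂ hK hB), h₁⟩

/-- If `𝒬` generates `𝓟`, an object with a finite `𝓟`-coresolution is the target of a deflation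
from an object with a finite `𝒬`-coresolution, with kernel in `𝓟`. -/
lemma Copres.exists_checkN_triangle
    (h𝓟 : ∀ {A B D : C}, S.HasTriangle A B D → 𝓟 A → 𝓟 D → 𝓟 B)
    (hgen : ∀ A, 𝓟 A → ∃ K T, 𝒬 T ∧ 𝓟 K ∧ S.HasTriangle K T A) {m : ℕ}
    (hA : S.Copres 𝓟 𝓟 m A) : ∃ K F, 𝓟 K ∧ S.checkN 𝒬 m F ∧ S.HasTriangle K F A := by
  induction m generalizing A with
  | zero =>
    obtain ⟨K, T, hT, hK, h⟩ := hgen A hA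
    exact ⟨K, T, hK, hT, h⟩
  | succ m ih =>
    obtain ⟨P, A', hP, hA', h⟩ := hA
    obtain ⟨K', Y, hK', hY, h'⟩ := ih hA'
    -- `E` is an extension of `P` by `K'`, hence in `𝓟`; a cover `T → E` composed with `E → Y` has
    -- the wanted `F` as kernel.
    obtain ⟨E, h₁, h₂⟩ := h.pullback h'
    obtain ⟨K, T, hT, hK, h₃⟩ := hgen E (h𝓟 h₂ hK' hP)
    obtain ⟨F, h₄, h₅⟩ := h₃.comp_deflation h₁
    exact ⟨K, F, hK, ⟨T, Y, hT, hY, h₄⟩, h₅⟩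

end Pres

/-! ### Finite `𝒯`-coresolutions. -/

section CheckN

variable {𝒯 : ObjectProperty C} {A B D : C}

lemma le_checkN (h𝒯 : IsAdditiveSubcategory 𝒯) (m : ℕ) : 𝒯 ≤ S.checkN 𝒯 m := by
  induction m with
  | zero => exact le_rfl
  | succ m ih => exact fun A hA => ⟨A, 0, hA, ih 0 (h𝒯.zero (isZero_zero C)),
      hasTriangle_id_zero S A (isZero_zero C)⟩

lemma checkN_le_succ (h𝒯 : IsAdditiveSubcategory 𝒯) (m : ℕ) :
    S.checkN 𝒯 m ≤ S.checkN 𝒯 (m + 1) := by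
  induction m with
  | zero => exact le_checkN h𝒯 1
  | succ m ih =>
    rintro A ⟨W, K, hW, hK, h⟩
    exact ⟨W, K, hW, ih K hK, h⟩

variable [S.EnoughProjectives]

lemma checkN.extVanishes_right (h𝒯o : S.IsSelfOrthogonal 𝒯) {m i : ℕ} (hA : 𝒯 A)
    (hB : S.checkN 𝒯 m B) (hi : m ≤ i) : S.ExtVanishes i A B := by
  induction m generalizing B i with
  | zero => exact h𝒯o B hB A hA i
  | succ m ih =>
    obtain ⟨T, Y, hT, hY, h⟩ := hB
    obtain ⟨i, rfl⟩ := Nat.exists_eq_succ_of_ne_zero (by omega : i ≠ 0)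
    exact h.extVanishes_first_right (ih hY (by omega)) (h𝒯o T hT A hA (i + 1))

variable [S.EnoughInjectives]

/-- The dual horseshoe: the pushout along `A → TA` splits because `𝔼(D, TA) = 0`. -/
lemma checkN.middle (h𝒯 : IsAdditiveSubcategory 𝒯) (h𝒯o : S.IsSelfOrthogonal 𝒯) {m : ℕ}
    (h : S.HasTriangle A B D) (hA : S.checkN 𝒯 m A) (hD : S.checkN 𝒯 m D) :
    S.checkN 𝒯 m B := by
  induction m generalizing A B D with
  | zero =>
    obtain ⟨e⟩ := h.nonempty_iso (h𝒯o A hA D hD 0)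
    exact h𝒯.iso e.symm (h𝒯.biprod hA hD)
  | succ m ih =>
    have hD₀ := hD
    obtain ⟨TA, A', hTA, hA', h₁⟩ := hA
    obtain ⟨TD, D', hTD, hD', h₂⟩ := hD
    obtain ⟨M, h₃, h₄⟩ := h.pushout h₁
    obtain ⟨e⟩ := h₃.nonempty_iso (hD₀.extVanishes (h𝒯o TA hTA) 0)
    have h₅ : S.HasTriangle M (TA ⊞ TD) D' :=
      ((hasTriangle_id_zero S TA (isZero_zero C)).biprod h₂).of_iso e.symm (Iso.refl _)
        (isoZeroBiprod (isZero_zero C)).symm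
    obtain ⟨N, h₆, h₇⟩ := h₄.comp_inflation h₅
    exact ⟨TA ⊞ TD, N, h𝒯.biprod hTA hTD, ih h₇ hA' hD', h₆⟩

/-- A direct complement of an object of `𝒯` in an object of `𝒯̌ₘ` lies in `𝒯̌ₘ`. -/
lemma checkN.of_biprod (h𝒯 : IsAdditiveSubcategory 𝒯) (h𝒯o : S.IsSelfOrthogonal 𝒯) {m : ℕ}
    (h : S.HasTriangle A B D) (e : B ≅ A ⊞ D) (hB : S.checkN 𝒯 m B) (hD : 𝒯 D) :
    S.checkN 𝒯 m A := by
  cases m with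
  | zero => exact h𝒯.summand (h𝒯.iso e hB)
  | succ m =>
    obtain ⟨T, Y, hT, hY, h'⟩ := hB
    obtain ⟨M, h₁, h₂⟩ := h.comp_inflation h'
    exact ⟨T, M, hT, .middle h𝒯 h𝒯o h₂ (le_checkN h𝒯 m D hD) hY, h₁⟩

end CheckN

/-! ### Bounds on the `𝒞`-dimension. -/

section Dimension

variable {𝒞 𝒯 : ObjectProperty C} {n : ℕ}

lemma hatN_of_dimSubcategory_le (h : S.dimSubcategory 𝒞 𝒯 ≤ n) {M : C} (hM : 𝒯 M) :
    ∃ m ≤ n, S.hatN 𝒞 m M := by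
  have h₁ : S.dim 𝒞 M ≤ n := (le_iSup₂_of_le M hM le_rfl).trans h
  have h₂ : S.dim 𝒞 M < (n + 1 : ℕ) := h₁.trans_lt (by exact_mod_cast n.lt_succ_self)
  simp only [dim, iInf_lt_iff] at h₂
  obtain ⟨m, hm, hmn⟩ := h₂
  exact ⟨m, by simpa [Nat.lt_succ_iff] using (by exact_mod_cast hmn : m < n + 1), hm⟩

lemma dimSubcategory_le_of_le_hatN (h : 𝒯 ≤ S.hatN 𝒞 n) : S.dimSubcategory 𝒞 𝒯 ≤ n :=
  iSup₂_le fun M hM => iInf₂_le n (h M hM)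

end Dimension

/-! ### The characterization of `n`-tilting pairs. -/

section Tilting

variable [S.EnoughProjectives] {𝒞 𝒯 : ObjectProperty C} {n : ℕ}

/-- An object of `𝒯` presents itself, padded by zeros; this takes at least one step, hence `1 ≤ n`.
-/
lemma le_of_Pres_leftX_eq (h𝒞 : IsAdditiveSubcategory 𝒞) (h𝒯 : IsAdditiveSubcategory 𝒯)
    (h𝒞o : S.IsSelfOrthogonal 𝒞) (hn : 1 ≤ n)
    (h : S.Pres 𝒯 (S.leftX 𝒞) n = S.rightPerp 𝒯 ⊓ S.leftX 𝒞) :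
    𝒯 ≤ S.rightPerp 𝒯 ⊓ S.leftX 𝒞 := by
  intro T hT
  rw [← h]
  obtain ⟨m, rfl⟩ := Nat.exists_eq_add_of_le' hn
  exact ⟨0, T, hT, Pres_zero_object (fun Z => h𝒯.zero)
    (fun Z hZ => le_leftX h𝒞 h𝒞o Z (h𝒞.zero hZ)) m (isZero_zero C),
    hasTriangle_zero_id S T (isZero_zero C)⟩

lemma exists_triangle_of_Pres_leftX_eq (h𝒞 : IsAdditiveSubcategory 𝒞)
    (h𝒯 : IsAdditiveSubcategory 𝒯) (h𝒞o : S.IsSelfOrthogonal 𝒞) (hn : 1 ≤ n)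
    (hfin : ∀ Z, S.rightPerp 𝒯 Z → S.leftX 𝒞 Z → ∃ (K W : C) (f : K ⟶ W) (g : W ⟶ Z),
      S.IsConflation f g ∧ IsRightApproximation 𝒯 g)
    (h : S.Pres 𝒯 (S.leftX 𝒞) n = S.rightPerp 𝒯 ⊓ S.leftX 𝒞) (A : C)
    (hA : (S.rightPerp 𝒯 ⊓ S.leftX 𝒞) A) :
    ∃ K T, 𝒯 T ∧ (S.rightPerp 𝒯 ⊓ S.leftX 𝒞) K ∧ S.HasTriangle K T A := by
  have hle := le_of_Pres_leftX_eq h𝒞 h𝒯 h𝒞o hn h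
  obtain ⟨K, T, f, g, hfg, hg⟩ := hfin A hA.1 hA.2
  have hK : S.rightPerp 𝒯 K :=
    rightPerp.kernel_of_isRightApproximation hfg (fun T hT => (hle T hT).1) hg hA.1
  refine ⟨K, T, hg.mem, ⟨hK, ?_⟩, ⟨f, g, hfg⟩⟩
  rw [← h] at hA
  obtain ⟨m, rfl⟩ := Nat.exists_eq_add_of_le' hn
  obtain ⟨K₁, T₁, hT₁, hK₁, hA₁⟩ := hA
  -- Compare the approximation with the first step of a presentation: `E` lies in `_𝒞𝒳` as an
  -- extension of `T` by `K₁`, and splits as `K ⊞ T₁`.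
  obtain ⟨E, h₁, h₂⟩ := hA₁.pullback ⟨f, g, hfg⟩
  have hE : S.leftX 𝒞 E := .middle h𝒞 h₁
    (Pres_leftX_le h𝒞 (fun T hT => (hle T hT).2) m K₁ hK₁) (hle T hg.mem).2
  obtain ⟨e⟩ := h₂.nonempty_iso (hK T₁ hT₁ 0)
  exact .of_biprod h𝒞 h𝒞o (hE.of_iso e)

variable [S.EnoughInjectives]

lemma Pres_leftX_le_of_isNTiltingPair (h𝒞 : IsAdditiveSubcategory 𝒞)
    (h : S.IsNTiltingPair n 𝒞 𝒯) :
    S.Pres 𝒯 (S.leftX 𝒞) n ≤ S.rightPerp 𝒯 ⊓ S.leftX 𝒞 := by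
  have h𝒯X : 𝒯 ≤ S.leftX 𝒞 := h.le_hat.trans (hat_le_leftX h𝒞 h.selfOrthogonal_left)
  refine fun A hA => ⟨fun M hM i => ?_, Pres_leftX_le h𝒞 h𝒯X n A hA⟩
  obtain ⟨m, hmn, hm⟩ := hatN_of_dimSubcategory_le h.dim_le hM
  -- Each presentation step trades one unit of `k` for one degree, so `k + i` is preserved until `k
  -- = 0`.
  have key : ∀ (k : ℕ) (A : C), S.Pres 𝒯 (S.leftX 𝒞) k A → ∀ i, m ≤ k + i →
      S.ExtVanishes i M A := by
    intro k
    induction k with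
    | zero => exact fun A hA i hi => hm.extVanishes (leftX.rightPerp hA) (by omega)
    | succ k ih =>
      rintro A ⟨K, T, hT, hK, hA⟩ i hi
      exact hA.extVanishes_last_right (h.selfOrthogonal_right T hT M hM i)
        (ih K hK (i + 1) (by omega))
  exact key n A hA i (by omega)

lemma le_Pres_leftX_of_isTiltingPair (h𝒞 : IsAdditiveSubcategory 𝒞)
    (h : S.IsTiltingPair 𝒞 𝒯)
    (hfin : ∀ Z, S.rightPerp 𝒯 Z → S.leftX 𝒞 Z → ∃ (K W : C) (f : K ⟶ W) (g : W ⟶ Z),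
      S.IsConflation f g ∧ IsRightApproximation 𝒯 g) (m : ℕ) :
    S.rightPerp 𝒯 ⊓ S.leftX 𝒞 ≤ S.Pres 𝒯 (S.leftX 𝒞) m := by
  have h𝒯X : 𝒯 ≤ S.leftX 𝒞 := h.le_hat.trans (hat_le_leftX h𝒞 h.selfOrthogonal_left)
  induction m with
  | zero => exact fun A hA => hA.2
  | succ m ih =>
    rintro A ⟨hA, hAX⟩
    obtain ⟨K, T, f, g, hfg, hg⟩ := hfin A hA hAX
    have hK : S.rightPerp 𝒯 K :=
      rightPerp.kernel_of_isRightApproximation hfg h.selfOrthogonal_right hg hA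
    exact ⟨K, T, hg.mem, ih K ⟨hK, .first h𝒞 h.selfOrthogonal_left ⟨f, g, hfg⟩
      (h𝒯X T hg.mem) hAX (rightPerp_le_of_le_check h.le_check K hK)⟩, ⟨f, g, hfg⟩⟩

lemma le_checkN_of_Pres_leftX_eq (h𝒞 : IsAdditiveSubcategory 𝒞)
    (h𝒯 : IsAdditiveSubcategory 𝒯) (h𝒞o : S.IsSelfOrthogonal 𝒞) (hn : 1 ≤ n)
    (hfin : ∀ Z, S.rightPerp 𝒯 Z → S.leftX 𝒞 Z → ∃ (K W : C) (f : K ⟶ W) (g : W ⟶ Z),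
      S.IsConflation f g ∧ IsRightApproximation 𝒯 g)
    (hcop : 𝒞 ≤ S.Copres (S.Pres 𝒯 (S.leftX 𝒞) n) ⊤ n)
    (h : S.Pres 𝒯 (S.leftX 𝒞) n = S.rightPerp 𝒯 ⊓ S.leftX 𝒞) :
    𝒞 ≤ S.checkN 𝒯 n := by
  have hle := le_of_Pres_leftX_eq h𝒞 h𝒯 h𝒞o hn h
  have hgen := exists_triangle_of_Pres_leftX_eq h𝒞 h𝒯 h𝒞o hn hfin h
  have hext : ∀ {A B D : C}, S.HasTriangle A B D → (S.rightPerp 𝒯 ⊓ S.leftX 𝒞) A →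
      (S.rightPerp 𝒯 ⊓ S.leftX 𝒞) D → (S.rightPerp 𝒯 ⊓ S.leftX 𝒞) B :=
    fun hT hA hD => ⟨rightPerp.middle hT hA.1 hD.1, .middle h𝒞 hT hA.2 hD.2⟩
  have hpres : S.Pres (S.rightPerp 𝒯 ⊓ S.leftX 𝒞) (S.leftX 𝒞) n ≤
      S.rightPerp 𝒯 ⊓ S.leftX 𝒞 :=
    (Pres_le_Pres_of_generator hext (fun hT hA hD => leftX.middle h𝒞 hT hA hD)
      inf_le_right hgen n).trans h.le
  intro W hW
  have hWX := le_leftX h𝒞 h𝒞o W hW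
  have hcW := hcop W hW
  rw [h] at hcW
  -- As `W ∈ _𝒞𝒳`, the last term has an `n`-step presentation by objects of `𝒬`, so it lies in `𝒬`
  -- by `hpres`.
  have hW₁ := Copres.tail_mem (S := S) (𝒳 := S.leftX 𝒞) (k := 0) hWX hcW
  rw [zero_add] at hW₁
  obtain ⟨K, F, hK, hF, hT⟩ := (Copres.mono_right hpres W hW₁).exists_checkN_triangle hext hgen
  obtain ⟨e⟩ := hT.nonempty_iso (hK.2.rightPerp W hW 0)
  obtain ⟨K', T, hT', hK', hKT⟩ := hgen K hK
  -- `K` is a summand of `F ∈ 𝒯̌ₙ` and `K' ∈ 𝒯^⊥`, so the cover of `K` splits too and `K` is a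
  -- summand of `T`.
  obtain ⟨e'⟩ := hKT.nonempty_iso (ExtVanishes.of_retract_left (i := 0) (biprod.inl ≫ e.inv)
    (e.hom ≫ biprod.fst) (by simp) (hF.extVanishes hK'.1 0))
  have hK𝒯 : 𝒯 K := h𝒯.summand (h𝒯.iso (e' ≪≫ biprod.braiding _ _) hT')
  let e'' := e ≪≫ biprod.braiding _ _
  exact .of_biprod h𝒯 (fun T hT => (hle T hT).1)
    ((hasTriangle_split S W K).of_iso (Iso.refl _) e''.symm (Iso.refl _)) e'' hF hK𝒯

/-- If `𝒞 ⊆ 𝒯̌ₘ`, every object of `_𝒞𝒳` is the target of a deflation from an object of `𝒯̌ₘ`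
with kernel in `Presᵏ(𝒯)`. -/
lemma exists_Pres_checkN_triangle (h𝒯 : IsAdditiveSubcategory 𝒯)
    (h𝒯o : S.IsSelfOrthogonal 𝒯) {m : ℕ} (hle : 𝒞 ≤ S.checkN 𝒯 (m + 1)) (k : ℕ) (A : C)
    (hA : S.leftX 𝒞 A) :
    ∃ B Z, S.Pres 𝒯 (S.leftX 𝒞) k B ∧ S.checkN 𝒯 (m + 1) Z ∧ S.HasTriangle B Z A := by
  induction k generalizing A with
  | zero =>
    obtain ⟨K, W, hW, hK, h⟩ := hA.exists_triangle
    exact ⟨K, W, hK, hle W hW, h⟩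
  | succ k ih =>
    obtain ⟨K, W, hW, hK, h⟩ := hA.exists_triangle
    obtain ⟨B, Z, hB, ⟨T, Y, hT, hY, h₂⟩, h₁⟩ := ih K hK
    -- The cone `B'` of `B → Z → T` gains a presentation step and contains `K`; pushing out along `K
    -- → W` gives `Z'`, an extension of `Y` by `W`.
    obtain ⟨B', h₃, h₄⟩ := h₁.comp_inflation h₂
    obtain ⟨Z', h₅, h₆⟩ := h₄.pushout h
    exact ⟨B', Z', ⟨B, T, hT, hB, h₃⟩,
      .middle h𝒯 h𝒯o h₅ (hle W hW) (checkN_le_succ h𝒯 m Y hY), h₆⟩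

/-- The characterization of `n`-tilting pairs, requiring right `𝒯`-approximations only for the
objects of `𝒯^⊥ ∩ _𝒞𝒳`. -/
theorem isNTiltingPair_iff (h𝒞 : IsAdditiveSubcategory 𝒞) (h𝒯 : IsAdditiveSubcategory 𝒯)
    (h𝒞o : S.IsSelfOrthogonal 𝒞) (hn : 1 ≤ n)
    (hfin : ∀ Z, S.rightPerp 𝒯 Z → S.leftX 𝒞 Z → ∃ (K W : C) (f : K ⟶ W) (g : W ⟶ Z),
      S.IsConflation f g ∧ IsRightApproximation 𝒯 g)
    (hcop : 𝒞 ≤ S.Copres (S.Pres 𝒯 (S.leftX 𝒞) n) ⊤ n) :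
    S.IsNTiltingPair n 𝒞 𝒯 ↔ S.Pres 𝒯 (S.leftX 𝒞) n = S.rightPerp 𝒯 ⊓ S.leftX 𝒞 := by
  refine ⟨fun h => le_antisymm (Pres_leftX_le_of_isNTiltingPair h𝒞 h)
    (le_Pres_leftX_of_isTiltingPair h𝒞 h.toIsTiltingPair hfin n), fun h => ?_⟩
  have hle := le_of_Pres_leftX_eq h𝒞 h𝒯 h𝒞o hn h
  have h𝒯o : S.IsSelfOrthogonal 𝒯 := fun T hT => (hle T hT).1
  have hcheck := le_checkN_of_Pres_leftX_eq h𝒞 h𝒯 h𝒞o hn hfin hcop h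
  have hhat : 𝒯 ≤ S.hatN 𝒞 n := by
    refine fun M hM => hatN_of_extVanishes h𝒞 (hle M hM).2 fun A hA => ?_
    obtain ⟨m, rfl⟩ := Nat.exists_eq_add_of_le' hn
    obtain ⟨B, Z, hB, hZ, hT⟩ := exists_Pres_checkN_triangle h𝒯 h𝒯o hcheck (m + 1) A hA
    rw [h] at hB
    -- `𝔼ⁿ⁺¹(M, A)` lies between `𝔼ⁿ⁺¹(M, Z)` and `𝔼ⁿ⁺²(M, B)`, both zero.
    exact hT.extVanishes_last_right (hZ.extVanishes_right h𝒯o hM le_rfl) (hB.1 M hM _)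
  exact { selfOrthogonal_left := h𝒞o
          selfOrthogonal_right := h𝒯o
          le_hat := fun M hM => ⟨n, hhat M hM⟩
          le_check := fun W hW => ⟨n, hcheck W hW⟩
          dim_le := dimSubcategory_le_of_le_hatN hhat }

end Tilting

end ExtriangulatedStructure

theorem mainTheorem1 {C : Type u} [Category.{v} C] [Preadditive C] [HasFiniteBiproducts C]
    (S : ExtriangulatedStructure.{w} C) (hKS : IsKrullSchmidtCategory C)
    [S.EnoughProjectives] [S.EnoughInjectives] (hWIC : S.WIC)
    (n : ℕ) (hn : 1 ≤ n) (𝒞 𝒯 : ObjectProperty C)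
    (h𝒞 : IsAdditiveSubcategory 𝒞) (h𝒯 : IsAdditiveSubcategory 𝒯)
    (h𝒞_orth : S.IsSelfOrthogonal 𝒞)
    (h𝒯_fin : S.IsStronglyContravariantlyFinite 𝒯)
    (h𝒞_copres : 𝒞 ≤ S.Copres (S.Pres 𝒯 (S.leftX 𝒞) n) ⊤ n) :
    S.IsNTiltingPair n 𝒞 𝒯 ↔
      S.Pres 𝒯 (S.leftX 𝒞) n = S.rightPerp 𝒯 ⊓ S.leftX 𝒞 :=
  ExtriangulatedStructure.isNTiltingPair_iff h𝒞 h𝒯 h𝒞_orth hn (fun Z _ _ => h𝒯_fin Z)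
    h𝒞_copres
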